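/- Let $a,b$ be the following $4\times 4$ matrices over the field $\mathbb{F}_3$ (dots stand for zeros): $$ a=\begin{pmatrix}.&1&.&.\\ .&.&1&.\\ .&.&.&1\\ -1&-1&-1&-1\end{pmatrix},\qquad b=\begin{pmatrix}1&.&.&.\\ .&.&1&.\\ -1&-1&-1&-1\\ .&1&.&.\end{pmatrix}. $$ Put $c_1=b$, $c_2=b^3$, $c_3=b^2$, $c_4=-b^2$, $d=(1,0,0,0)\in\mathbb{F}_3^4$, and consider the $17\times 17$ matrices over $\mathbb{F}_3$, in block form with diagonal blocks of sizes $1,4,4,4,4$, $$ A=\operatorname{diag}(1,a,a,a,a),\qquad B=\operatorname{diag}(1,b,b,b,b), $$ $$ C=\left(\begin{array}{c|cccc}1&.&.&.&.\\ \hline .&1&c_1&c_3&.\\ .&.&1&.&c_4\\ .&.&.&1&c_2\\ .&.&.&.&1\end{array}\right),\qquad D=\left(\begin{array}{c|cccc}1&d&.&.&.\\ \hline .&1&.&.&.\\ .&.&1&.&.\\ .&.&.&1&.\\ .&.&.&.&1\end{array}\right). $$ Let $G=\langle A,B,C,D\rangle\le \mathrm{GL}_{17}(\mathbb{F}_3)$,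 let $P$ be the normal closure of $\{C,D\}$ in $G$, and let $F=\langle A,B\rangle$. Then: 1. $G$ is solvable, $|G|=2^2\cdot 3^{24}\cdot 5$, and $G$ is isospectral to $S_4(3)=\mathrm{PSp}_4(3)$, i.e. the set of orders of elements of $G$ equals the set of orders of elements of $\mathrm{PSp}_4(3)$. The elements of the latter set that are maximal with respect to divisibility are exactly $5$, $9$ and $12$. 2. $G$ is the (internal) semidirect product $P\rtimes F$, where $P$ is the largest normal $3$-subgroup of $G$, has exponent $9$ and order $3^{24}$, and $F$ is a Frobenius group of shape $5:4$ with kernel $\langle A\rangle$ of order $5$ and complement $\langle B\rangle$ of order $4$. -/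

import Mathlib

namespace SolvIso

open Matrix

/-! ### Element orders -/

/-- The spectrum `ω(G)` of a (finite) group: the set of its element orders. -/
def elementOrders (G : Type*) [Group G] : Set ℕ := {n | ∃ g : G, orderOf g = n}

/-- The set `μ(G)` of those element orders that are maximal with respect to divisibility. -/
def maxElementOrders (G : Type*) [Group G] : Set ℕ :=
  {n | n ∈ elementOrders G ∧ ∀ m ∈ elementOrders G, n ∣ m → m = n}

/-- Two groups are isospectral if they have the same set of element orders. -/
def Isospectral (G H : Type*) [Group G] [Group H] : Prop := elementOrders G = elementOrders H

/-- The group `S₄(3) = PSp₄(3)`: the symplectic group of `4 × 4` matrices over `𝔽₃`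
modulo its center. -/
abbrev S43 : Type :=
  Matrix.symplecticGroup (Fin 2) (ZMod 3) ⧸
    Subgroup.center (Matrix.symplecticGroup (Fin 2) (ZMod 3))

/-- `Γ` is a Frobenius group with kernel `K` and complement `H`: it is the semidirect product of
its nontrivial normal subgroup `K` by its nontrivial subgroup `H`, and no nontrivial element of `H`
centralizes a nontrivial element of `K`. -/
structure IsFrobenius {Γ : Type*} [Group Γ] (K H : Subgroup Γ) : Prop where
  normal : K.Normal
  isComplement : Subgroup.IsComplement' K H
  kernel_ne_bot : K ≠ ⊥
  complement_ne_bot : H ≠ ⊥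
  fixedPointFree : ∀ h ∈ H, h ≠ 1 → ∀ k ∈ K, h * k = k * h → k = 1

/-! ### The matrices -/

/-- `4 × 4` matrices over `𝔽₃`. -/
abbrev M4 : Type := Matrix (Fin 4) (Fin 4) (ZMod 3)

/-- The generator `a` of order `5`. -/
def a : M4 :=
  !![ 0,  1,  0,  0;
      0,  0,  1,  0;
      0,  0,  0,  1;
     -1, -1, -1, -1]

/-- The generator `b` of order `4`. -/
def b : M4 :=
  !![ 1,  0,  0,  0;
      0,  0,  1,  0;
     -1, -1, -1, -1;
      0,  1,  0,  0]

/-- The `17` row and column indices: one single index, followed by four blocks of length four. -/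
abbrev Idx : Type := Fin 1 ⊕ Fin 4 × Fin 4

/-- The `17 × 17` matrix with `1` in the top left corner, zeros below it, first row completed by the
four row vectors `r 0, …, r 3` of length `4`, and lower right part the `4 × 4` block matrix `X` with
`4 × 4` blocks. -/
def blockMat (r : Fin 4 → Fin 4 → ZMod 3) (X : Matrix (Fin 4) (Fin 4) M4) :
    Matrix Idx Idx (ZMod 3) :=
  Matrix.fromBlocks 1 (Matrix.of fun _ p => r p.1 p.2) 0 (Matrix.compRingEquiv (Fin 4) (Fin 4) _ X)

/-- `diag(1, a, a, a, a)`. -/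
def matA : Matrix Idx Idx (ZMod 3) := blockMat 0 (Matrix.diagonal fun _ => a)

/-- `diag(1, b, b, b, b)`. -/
def matB : Matrix Idx Idx (ZMod 3) := blockMat 0 (Matrix.diagonal fun _ => b)

def c1 : M4 := b
def c2 : M4 := b ^ 3
def c3 : M4 := b ^ 2
def c4 : M4 := -b ^ 2

/-- The block matrix `C`. -/
def matC : Matrix Idx Idx (ZMod 3) :=
  blockMat 0
    !![1, c1, c3, 0;
       0, 1, 0, c4;
       0, 0, 1, c2;
       0, 0, 0, 1]

/-- The row vector `d`. -/
def d : Fin 4 → ZMod 3 := ![1, 0, 0, 0]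

/-- The block matrix `D`. -/
def matD : Matrix Idx Idx (ZMod 3) := blockMat ![d, 0, 0, 0] 1

/-! ### Invertibility of the four matrices -/

theorem blockMat_zero_mul (X Y : Matrix (Fin 4) (Fin 4) M4) :
    blockMat 0 X * blockMat 0 Y = blockMat 0 (X * Y) := by
  have h : (Matrix.of fun (_ : Fin 1) (p : Fin 4 × Fin 4) =>
      (0 : Fin 4 → Fin 4 → ZMod 3) p.1 p.2) = 0 := rfl
  simp only [blockMat, Matrix.fromBlocks_multiply, h, map_mul]
  simp

theorem blockMat_row_mul (r s : Fin 4 → Fin 4 → ZMod 3) :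
    blockMat r 1 * blockMat s 1 = blockMat (r + s) 1 := by
  simp only [blockMat, Matrix.fromBlocks_multiply, map_one]
  simp only [Matrix.mul_one, Matrix.one_mul, Matrix.mul_zero, Matrix.zero_mul, add_zero, zero_add]
  congr 1
  ext i p
  simp [add_comm]

theorem blockMat_zero_one : blockMat 0 1 = 1 := by
  have h : (Matrix.of fun (_ : Fin 1) (p : Fin 4 × Fin 4) =>
      (0 : Fin 4 → Fin 4 → ZMod 3) p.1 p.2) = 0 := rfl
  simp only [blockMat, h, map_one, Matrix.fromBlocks_one]

theorem a_pow : a ^ 5 = 1 := by decide +kernel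

theorem b_pow : b ^ 4 = 1 := by decide +kernel

/-- The inverse of the lower right part of `C`. -/
def lowerCInv : Matrix (Fin 4) (Fin 4) M4 :=
  !![1, -c1, -c3, c1 * c4 + c3 * c2;
     0, 1, 0, -c4;
     0, 0, 1, -c2;
     0, 0, 0, 1]

/-- `A` as an invertible matrix. -/
def uA : GL Idx (ZMod 3) where
  val := matA
  inv := blockMat 0 (Matrix.diagonal fun _ => a ^ 4)
  val_inv := by
    rw [matA, blockMat_zero_mul, Matrix.diagonal_mul_diagonal, ← blockMat_zero_one]
    simp only [← pow_succ', Nat.reduceAdd, a_pow, Matrix.diagonal_one]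
  inv_val := by
    rw [matA, blockMat_zero_mul, Matrix.diagonal_mul_diagonal, ← blockMat_zero_one]
    simp only [← pow_succ, Nat.reduceAdd, a_pow, Matrix.diagonal_one]

/-- `B` as an invertible matrix. -/
def uB : GL Idx (ZMod 3) where
  val := matB
  inv := blockMat 0 (Matrix.diagonal fun _ => b ^ 3)
  val_inv := by
    rw [matB, blockMat_zero_mul, Matrix.diagonal_mul_diagonal, ← blockMat_zero_one]
    simp only [← pow_succ', Nat.reduceAdd, b_pow, Matrix.diagonal_one]
  inv_val := by
    rw [matB, blockMat_zero_mul, Matrix.diagonal_mul_diagonal, ← blockMat_zero_one]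
    simp only [← pow_succ, Nat.reduceAdd, b_pow, Matrix.diagonal_one]

/-- `C` as an invertible matrix. -/
def uC : GL Idx (ZMod 3) where
  val := matC
  inv := blockMat 0 lowerCInv
  val_inv := by
    rw [matC, blockMat_zero_mul, ← blockMat_zero_one, lowerCInv]
    congr 1
    ext1 i j
    fin_cases i <;> fin_cases j <;> simp [Matrix.mul_apply, Fin.sum_univ_four]
  inv_val := by
    rw [matC, blockMat_zero_mul, ← blockMat_zero_one, lowerCInv]
    congr 1
    ext1 i j
    fin_cases i <;> fin_cases j <;> simp [Matrix.mul_apply, Fin.sum_univ_four]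
    abel

/-- `D` as an invertible matrix. -/
def uD : GL Idx (ZMod 3) where
  val := matD
  inv := blockMat (-![d, 0, 0, 0]) 1
  val_inv := by
    rw [matD, blockMat_row_mul, add_neg_cancel, blockMat_zero_one]
  inv_val := by
    rw [matD, blockMat_row_mul, neg_add_cancel, blockMat_zero_one]

/-! ### The group -/

/-- The group `G = ⟨A, B, C, D⟩`. -/
def G : Subgroup (GL Idx (ZMod 3)) := Subgroup.closure {uA, uB, uC, uD}

/-- The generator `A` as an element of `G`. -/
def gA : G := ⟨uA, Subgroup.subset_closure (by simp)⟩

/-- The generator `B` as an element of `G`. -/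
def gB : G := ⟨uB, Subgroup.subset_closure (by simp)⟩

/-- The generator `C` as an element of `G`. -/
def gC : G := ⟨uC, Subgroup.subset_closure (by simp)⟩

/-- The generator `D` as an element of `G`. -/
def gD : G := ⟨uD, Subgroup.subset_closure (by simp)⟩

/-- `P = ⟨C, D⟩^G`, the normal closure of `{C, D}` in `G`. -/
def P : Subgroup G := Subgroup.normalClosure {gC, gD}

/-- `F = ⟨A, B⟩`. -/
def F : Subgroup G := Subgroup.closure {gA, gB}

/-- The generator `A` as an element of `F`. -/
def fA : F := ⟨gA, Subgroup.subset_closure (by simp)⟩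

/-- The generator `B` as an element of `F`. -/
def fB : F := ⟨gB, Subgroup.subset_closure (by simp)⟩

end SolvIso

namespace SolvIso

open Matrix

section S43

open Polynomial

/-! ### Groups whose element orders are the divisors of `5`, `9` and `12` -/

/-! Both groups have as element orders exactly the divisors of 5, 9 and 12.

For `S43`, a symplectic matrix has a self-reciprocal characteristic polynomial `X^4 + cX^3 + eX^2 +
cX + 1`. Each of the nine such polynomials over `𝔽₃` divides `X^n - 1` or `X^n + 1` for some n in
{5, 9, 12}, so by Cayley–Hamilton `M^n = ±1`. Explicit matrices realize the three orders.

For `G`, conjugation by `b` acts on the field `L = 𝔽₃[a]` as Frobenius (`sigma a = a ^ 3`), and row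
vectors form a free `L`-module of rank one on `d`. The group `P` consists of the matrices `blockMat
r (T x p)` with an arbitrary row `r` (16 dimensions over `𝔽₃`) and x, p in `L` (4 dimensions each),
whence the order 3^24. These matrices form a group (`T_mul_T`) normalized by `A` and `B`
(`T_mul_diagonal_a`, `T_mul_diagonal_b`), and `blockGroup_le` shows that `C`, `D` and conjugation by
`A` generate all of it.

The orders in `G` are read off coset by coset of `P`. In `P` itself ninth powers vanish
(`blockMat_T_pow_nine`). A nontrivial power of `A` has no nontrivial fixed point on `P`, so every
element of its coset is conjugate to it and has order 5. For the other elements f of `F`, either f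
or its square is conjugate to `B^2`, so it suffices that sixth powers vanish on the coset of `B^2`
(`mul_uB_sq_pow_six`). This is the delicate point, which excludes order 18: it comes down to `(b^2 +
1)(b - b^3) = 0`. -/

theorem elementOrders_of_dvd {Γ : Type*} [Group Γ]
    (h : ∀ g : Γ, g ^ 5 = 1 ∨ g ^ 9 = 1 ∨ g ^ 12 = 1)
    (h5 : ∃ g : Γ, orderOf g = 5) (h9 : ∃ g : Γ, orderOf g = 9) (h12 : ∃ g : Γ, orderOf g = 12) :
    elementOrders Γ = {n | n ∣ 5 ∨ n ∣ 9 ∨ n ∣ 12} := by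
  -- The set of element orders is closed under divisors, so realizing 5, 9 and 12 is enough.
  have key : ∀ {m n : ℕ}, 0 < m → (∃ g : Γ, orderOf g = m) → n ∣ m → ∃ g : Γ, orderOf g = n := by
    rintro m n hm ⟨g, hg⟩ ⟨k, hk⟩
    have hk0 : k ≠ 0 := by rintro rfl; omega
    refine ⟨g ^ k, ?_⟩
    rw [orderOf_pow_of_dvd hk0 (hg ▸ hk ▸ dvd_mul_left k n), hg, hk]
    exact Nat.mul_div_cancel _ (Nat.pos_of_ne_zero hk0)
  ext n
  constructor
  · rintro ⟨g, rfl⟩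
    simpa only [Set.mem_ofPred_eq, orderOf_dvd_iff_pow_eq_one] using h g
  · rintro (hn | hn | hn)
    · exact key (by norm_num) h5 hn
    · exact key (by norm_num) h9 hn
    · exact key (by norm_num) h12 hn

theorem maxElementOrders_of_elementOrders {Γ : Type*} [Group Γ]
    (h : elementOrders Γ = {n | n ∣ 5 ∨ n ∣ 9 ∨ n ∣ 12}) :
    maxElementOrders Γ = {5, 9, 12} := by
  ext n
  simp only [maxElementOrders, h, Set.mem_ofPred_eq, Set.mem_insert_iff, Set.mem_singleton_iff]
  constructor
  · rintro ⟨hn | hn | hn, hm⟩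
    · exact .inl (hm 5 (by norm_num) hn).symm
    · exact .inr (.inl (hm 9 (by norm_num) hn).symm)
    · exact .inr (.inr (hm 12 (by norm_num) hn).symm)
  · have aux : ∀ m < 13, ∀ k ∈ ({5, 9, 12} : Finset ℕ), (m ∣ 5 ∨ m ∣ 9 ∨ m ∣ 12) →
        k ∣ m → m = k := by decide
    intro hn
    refine ⟨by rcases hn with rfl | rfl | rfl <;> norm_num, fun m hm hd => ?_⟩
    refine aux m ?_ n (by simpa using hn) hm hd
    rcases hm with hm | hm | hm <;> have := Nat.le_of_dvd (by norm_num) hm <;> omega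

/-! ### The element orders of `S₄(3)` -/

/-- The inverse `-J Mᵀ J` of `M` is similar to `Mᵀ`, hence has the characteristic polynomial of `M`;
for determinant 1 the characteristic polynomial of the inverse is also the reversed one, up to a
sign that is trivial in even dimension. -/
theorem symplectic_charpoly_reverse {l K : Type*} [Fintype l] [DecidableEq l] [Field K]
    {M : Matrix (l ⊕ l) (l ⊕ l) K} (hM : M ∈ symplecticGroup l K) :
    M.charpoly.reverse = M.charpoly := by
  have hdet := SymplecticGroup.det_eq_one hM
  have hu : IsUnit M := (Matrix.isUnit_iff_isUnit_det M).2 (by simp [hdet])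
  have h1 := Matrix.charpoly_inv M hu
  rw [SymplecticGroup.inv_eq_symplectic_inv M hM, neg_mul, neg_mul, ← mul_neg,
    Matrix.charpoly_mul_comm, ← mul_assoc, neg_mul, J_squared, neg_neg, one_mul,
    charpoly_transpose, hdet, ← Matrix.reverse_charpoly] at h1
  simpa [Fintype.card_sum, ← two_mul] using h1.symm

theorem symplectic_pow_eq (M : symplecticGroup (Fin 2) (ZMod 3)) :
    ∃ n ∈ ({5, 9, 12} : Set ℕ), (M : Matrix (Fin 2 ⊕ Fin 2) (Fin 2 ⊕ Fin 2) (ZMod 3)) ^ n = 1 ∨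
      (M : Matrix (Fin 2 ⊕ Fin 2) (Fin 2 ⊕ Fin 2) (ZMod 3)) ^ n = -1 := by
  obtain ⟨M, hM⟩ := M
  simp only
  have hdeg : M.charpoly.natDegree = 4 := by simp [Matrix.charpoly_natDegree_eq_dim]
  have hrev : ∀ i ≤ 4, M.charpoly.coeff (4 - i) = M.charpoly.coeff i := by
    intro i hi
    conv_rhs => rw [← symplectic_charpoly_reverse hM, coeff_reverse, hdeg, revAt_le hi]
  have h4 : M.charpoly.coeff 4 = 1 := by
    rw [← hdeg]; exact (Matrix.charpoly_monic M).coeff_natDegree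
  have h0 : M.charpoly.coeff 0 = 1 := by rw [← hrev 0 (by norm_num)]; exact h4
  have h3 := hrev 1 (by norm_num)
  have hp := M.charpoly.as_sum_range_C_mul_X_pow
  rw [hdeg] at hp
  simp only [Finset.sum_range_succ, Finset.sum_range_zero, h4, h0, zero_add] at hp
  norm_num at h3
  rw [h3] at hp
  have hz := Matrix.aeval_self_charpoly M
  have hchar : (3 : (ZMod 3)[X]) = 0 := by
    have h : (3 : ZMod 3) = 0 := by decide
    rw [← map_ofNat C, h, map_zero]
  -- Cayley–Hamilton: a multiple of the characteristic polynomial vanishes at `M`. The polynomials q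
  -- supplied below are the quotients of `X^n ∓ 1`; where the identity holds only modulo 3, `hchar`
  -- absorbs the difference.
  have key : ∀ (n : ℕ) (s : ZMod 3) (q : (ZMod 3)[X]), X ^ n - C s = M.charpoly * q →
      M ^ n = algebraMap _ _ s := by
    intro n s q h
    have := congrArg (aeval M) h
    rw [map_mul, hz, zero_mul, map_sub, map_pow, aeval_X, aeval_C] at this
    exact sub_eq_zero.1 this
  generalize M.charpoly.coeff 1 = c at hp
  generalize M.charpoly.coeff 2 = e at hp
  have hcase : ∀ x : ZMod 3, x = 0 ∨ x = 1 ∨ x = -1 := by decide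
  rcases hcase c with rfl | rfl | rfl <;> rcases hcase e with rfl | rfl | rfl <;>
    simp only [map_zero, map_one, map_neg] at hp
  · exact ⟨12, by simp, .inr (by
      simpa using key 12 (-1) (1 - X ^ 4 + X ^ 8) (by
        rw [hp]
        simp
        ring))⟩
  · exact ⟨12, by simp, .inl (by
      simpa using key 12 (1) (-1 + X ^ 2 - X ^ 6 + X ^ 8) (by
        rw [hp]
        simp
        ring))⟩
  · exact ⟨12, by simp, .inl (by
      simpa using key 12 (1) (-1 - X ^ 2 + X ^ 6 + X ^ 8) (by
        rw [hp]
        simp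
        ring))⟩
  · exact ⟨9, by simp, .inr (by
      simpa using key 9 (-1) (1 - X + X ^ 2 + X ^ 3 - X ^ 4 + X ^ 5) (by
        rw [hp]
        simp
        linear_combination (-X ^ 3 - X ^ 6) * hchar))⟩
  · exact ⟨5, by simp, .inl (by
      simpa using key 5 (1) (-1 + X) (by
        rw [hp]
        simp
        ring))⟩
  · exact ⟨12, by simp, .inl (by
      simpa using key 12 (1) (-1 + X + X ^ 2 + X ^ 3 - X ^ 5 - X ^ 6 - X ^ 7 + X ^ 8) (by
        rw [hp]
        simp
        linear_combination (-X ^ 2 + X ^ 10) * hchar))⟩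
  · exact ⟨9, by simp, .inl (by
      simpa using key 9 (1) (-1 - X - X ^ 2 + X ^ 3 + X ^ 4 + X ^ 5) (by
        rw [hp]
        simp
        linear_combination (-X ^ 3 + X ^ 6) * hchar))⟩
  · exact ⟨5, by simp, .inr (by
      simpa using key 5 (-1) (1 + X) (by
        rw [hp]
        simp
        ring))⟩
  · exact ⟨12, by simp, .inl (by
      simpa using key 12 (1) (-1 - X + X ^ 2 - X ^ 3 + X ^ 5 - X ^ 6 + X ^ 7 + X ^ 8) (by
        rw [hp]
        simp
        linear_combination (-X ^ 2 + X ^ 10) * hchar))⟩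

theorem symplectic_mem_center {M : symplecticGroup (Fin 2) (ZMod 3)}
    (h : (M : Matrix (Fin 2 ⊕ Fin 2) (Fin 2 ⊕ Fin 2) (ZMod 3)) = 1 ∨
      (M : Matrix (Fin 2 ⊕ Fin 2) (Fin 2 ⊕ Fin 2) (ZMod 3)) = -1) :
    M ∈ Subgroup.center (symplecticGroup (Fin 2) (ZMod 3)) := by
  rw [Subgroup.mem_center_iff]
  intro N
  apply Subtype.ext
  rcases h with h | h <;> simp [h]

theorem S43_mk_pow_eq_one {M : symplecticGroup (Fin 2) (ZMod 3)} {n : ℕ} :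
    (QuotientGroup.mk M : S43) ^ n = 1 ↔
      M ^ n ∈ Subgroup.center (symplecticGroup (Fin 2) (ZMod 3)) := by
  rw [← QuotientGroup.mk_pow, QuotientGroup.eq_one_iff]

theorem symplectic_notMem_center {M : symplecticGroup (Fin 2) (ZMod 3)}
    {N : Matrix (Fin 2 ⊕ Fin 2) (Fin 2 ⊕ Fin 2) (ZMod 3)} (hN : N ∈ symplecticGroup _ _)
    (h : (M : Matrix (Fin 2 ⊕ Fin 2) (Fin 2 ⊕ Fin 2) (ZMod 3)) * N ≠ N * M) :
    M ∉ Subgroup.center (symplecticGroup (Fin 2) (ZMod 3)) := fun hM =>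
  h (congrArg Subtype.val (Subgroup.mem_center_iff.1 hM ⟨N, hN⟩)).symm

theorem S43_exists_orderOf_eq_five : ∃ g : S43, orderOf g = 5 := by
  have hM : fromBlocks 0 (-1) 1 !![1, 2; 2, 0] ∈ symplecticGroup (Fin 2) (ZMod 3) := by
    rw [SymplecticGroup.mem_iff]; decide +kernel
  have : Fact (Nat.Prime 5) := ⟨by norm_num⟩
  refine ⟨QuotientGroup.mk ⟨_, hM⟩, orderOf_eq_prime (p := 5) ?_ ?_⟩
  · exact S43_mk_pow_eq_one.2 (symplectic_mem_center (.inr (by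
      rw [SubmonoidClass.coe_pow]; dsimp only; decide +kernel)))
  · rw [Ne, QuotientGroup.eq_one_iff]
    exact symplectic_notMem_center (SymplecticGroup.J_mem _ _) (by dsimp only; decide +kernel)

theorem S43_exists_orderOf_eq_nine : ∃ g : S43, orderOf g = 9 := by
  have hM : fromBlocks !![2, 0; 2, 0] !![0, 1; 0, 0] !![0, 2; 0, 1] !![0, 0; 2, 0] ∈
      symplecticGroup (Fin 2) (ZMod 3) := by
    rw [SymplecticGroup.mem_iff]; decide +kernel
  refine ⟨QuotientGroup.mk ⟨_, hM⟩, orderOf_eq_prime_pow (p := 3) (n := 1) ?_ ?_⟩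
  · rw [S43_mk_pow_eq_one]
    exact symplectic_notMem_center (SymplecticGroup.J_mem _ _) (by
      rw [SubmonoidClass.coe_pow]; dsimp only; decide +kernel)
  · exact S43_mk_pow_eq_one.2 (symplectic_mem_center (.inr (by
      rw [SubmonoidClass.coe_pow]; dsimp only; decide +kernel)))

theorem S43_exists_orderOf_eq_twelve : ∃ g : S43, orderOf g = 12 := by
  have hM : fromBlocks 0 1 (-1) !![2, 0; 0, 0] ∈ symplecticGroup (Fin 2) (ZMod 3) := by
    rw [SymplecticGroup.mem_iff]; decide +kernel
  -- A symplectic matrix commuting with neither `M^6` nor `M^4`, which shows that both powers are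
  -- non-central.
  have hN : fromBlocks !![2, 0; 2, 0] !![0, 1; 0, 0] !![0, 2; 0, 1] !![0, 0; 2, 0] ∈
      symplecticGroup (Fin 2) (ZMod 3) := by
    rw [SymplecticGroup.mem_iff]; decide +kernel
  refine ⟨QuotientGroup.mk ⟨_, hM⟩,
    orderOf_eq_of_pow_and_pow_div_prime (by norm_num) ?_ fun p hp hd => ?_⟩
  · exact S43_mk_pow_eq_one.2 (symplectic_mem_center (.inl (by
      rw [SubmonoidClass.coe_pow]; dsimp only; decide +kernel)))
  · rw [Ne, S43_mk_pow_eq_one]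
    have h : p = 2 ∨ p = 3 := by
      rw [show 12 = 2 ^ 2 * 3 by rfl, hp.dvd_mul] at hd
      exact hd.imp (fun h => (Nat.prime_dvd_prime_iff_eq hp Nat.prime_two).1 (hp.dvd_of_dvd_pow h))
        (Nat.prime_dvd_prime_iff_eq hp Nat.prime_three).1
    rcases h with rfl | rfl <;> exact symplectic_notMem_center hN (by
      rw [SubmonoidClass.coe_pow]; dsimp only; decide +kernel)

theorem elementOrders_S43 : elementOrders S43 = {n | n ∣ 5 ∨ n ∣ 9 ∨ n ∣ 12} := by
  refine elementOrders_of_dvd (fun g => ?_) S43_exists_orderOf_eq_five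
    S43_exists_orderOf_eq_nine S43_exists_orderOf_eq_twelve
  induction g using QuotientGroup.induction_on with
  | H M =>
    obtain ⟨n, hn, h⟩ := symplectic_pow_eq M
    have h1 : (QuotientGroup.mk M : S43) ^ n = 1 :=
      S43_mk_pow_eq_one.2 (symplectic_mem_center (by rwa [SubmonoidClass.coe_pow]))
    rcases hn with rfl | rfl | rfl
    · exact .inl h1
    · exact .inr (.inl h1)
    · exact .inr (.inr h1)

end S43

/-! ### The subalgebra generated by `a` and conjugation by `b` -/

/-- The subalgebra `𝔽₃[a]`, a field with `81` elements. -/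
def L : Subalgebra (ZMod 3) M4 := Algebra.adjoin (ZMod 3) {a}

theorem a_mem_L : a ∈ L := Algebra.subset_adjoin rfl

theorem L_mul_comm {x y : M4} (hx : x ∈ L) (hy : y ∈ L) : x * y = y * x :=
  Algebra.commute_of_mem_adjoin_of_forall_mem_commute (R := ZMod 3) hy (fun z hz => by
    rw [Set.mem_singleton_iff.1 hz]
    exact (Algebra.commute_of_mem_adjoin_self hx).symm)

theorem b_mul_a : b * a = a ^ 3 * b := by decide +kernel

theorem b_mul_b_pow_three : b * b ^ 3 = 1 := by rw [← pow_succ', b_pow]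

theorem b_pow_three_mul_b : b ^ 3 * b = 1 := by rw [← pow_succ, b_pow]

/-- Conjugation by `b`. -/
def sigma : M4 →ₐ[ZMod 3] M4 where
  toFun x := b * x * b ^ 3
  map_one' := by rw [mul_one, b_mul_b_pow_three]
  map_mul' x y := by
    rw [show b * x * b ^ 3 * (b * y * b ^ 3) = b * x * (b ^ 3 * b) * y * b ^ 3 by
      simp only [mul_assoc], b_pow_three_mul_b, mul_one]
    simp only [mul_assoc]
  map_zero' := by simp
  map_add' x y := by simp only [mul_add, add_mul]
  commutes' r := by
    rw [← Algebra.commutes, mul_assoc, b_mul_b_pow_three, mul_one]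

theorem sigma_apply (x : M4) : sigma x = b * x * b ^ 3 := rfl

theorem b_mul (x : M4) : b * x = sigma x * b := by
  rw [sigma_apply, mul_assoc, b_pow_three_mul_b, mul_one]

theorem sigma_a : sigma a = a ^ 3 := by
  rw [sigma_apply, b_mul_a, mul_assoc, b_mul_b_pow_three, mul_one]

theorem b_sq_mul (x : M4) : b ^ 2 * x = sigma (sigma x) * b ^ 2 := by
  rw [pow_two, mul_assoc, b_mul x, ← mul_assoc, b_mul (sigma x), mul_assoc]

theorem b_cube_mul (x : M4) : b ^ 3 * x = sigma (sigma (sigma x)) * b ^ 3 := by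
  rw [pow_succ, mul_assoc, b_mul x, ← mul_assoc, b_sq_mul, mul_assoc]

theorem sigma_four (x : M4) : sigma (sigma (sigma (sigma x))) = x := by
  rw [sigma_apply (sigma _), mul_assoc, ← b_cube_mul, ← mul_assoc, b_mul_b_pow_three, one_mul]

theorem sigma_mem {x : M4} (hx : x ∈ L) : sigma x ∈ L := by
  have h : L.map sigma ≤ L := by
    rw [L, AlgHom.map_adjoin_singleton, sigma_a]
    exact Algebra.adjoin_singleton_le (pow_mem a_mem_L 3)
  exact h ⟨x, hx, rfl⟩

theorem three_eq_zero (x : M4) : x + x + x = 0 := by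
  have : (3 : ZMod 3) • x = 0 := by rw [show (3 : ZMod 3) = 0 by decide, zero_smul]
  rw [← this, show (3 : ZMod 3) = 1 + 1 + 1 by decide]
  simp only [add_smul, one_smul]

/-- Since `a` is a companion matrix, the vectors `d a^i` for i < 4 are the standard basis. -/
theorem d_vecMul_eq (v : Fin 4 → ZMod 3) : d ᵥ* (∑ i : Fin 4, v i • a ^ (i : ℕ)) = v := by
  have h : ∀ i j : Fin 4, (d ᵥ* a ^ (i : ℕ)) j = if i = j then 1 else 0 := by decide +kernel
  ext j
  simp only [Matrix.vecMul_sum, Matrix.vecMul_smul, Finset.sum_apply, Pi.smul_apply, h,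
    smul_eq_mul]
  simp

theorem sum_mem_L (v : Fin 4 → ZMod 3) : ∑ i, v i • a ^ (i : ℕ) ∈ L :=
  sum_mem fun _ _ => L.smul_mem (pow_mem a_mem_L _) _

/-- Every row vector is `d z` with z in the commutative algebra `L`, so a matrix of `L` killing `d`
kills everything. -/
theorem L_eq_zero {x : M4} (hx : x ∈ L) (h : d ᵥ* x = 0) : x = 0 := by
  have hv : ∀ v, v ᵥ* x = 0 := fun v => by
    rw [← d_vecMul_eq v, vecMul_vecMul, L_mul_comm (sum_mem_L v) hx, ← vecMul_vecMul, h,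
      zero_vecMul]
  ext i j
  simpa using congrFun (hv (Pi.single i 1)) j

/-- The elements of `𝔽₃[a]` are determined by their first rows, which are arbitrary. -/
def firstRowEquiv : L ≃ (Fin 4 → ZMod 3) where
  toFun x := d ᵥ* (x : M4)
  invFun v := ⟨∑ i, v i • a ^ (i : ℕ), sum_mem_L v⟩
  left_inv x := by
    apply Subtype.ext
    refine sub_eq_zero.1 (L_eq_zero (sub_mem (sum_mem_L _) x.2) ?_)
    rw [vecMul_sub, d_vecMul_eq, sub_self]
  right_inv v := d_vecMul_eq v

/-- A set of row vectors stable under `a` and containing a generator is everything. -/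
theorem vec_eq_top (S : AddSubmonoid (Fin 4 → ZMod 3)) (hS : ∀ v ∈ S, v ᵥ* a ∈ S)
    {w : Fin 4 → ZMod 3} (hw : w ∈ S) {y : M4} (hy : y ∈ L) (hd : w ᵥ* y = d)
    (v : Fin 4 → ZMod 3) : v ∈ S := by
  have key : ∀ z ∈ L, ∀ v ∈ S, v ᵥ* z ∈ S := by
    intro z hz
    induction hz using Algebra.adjoin_induction with
    | mem z hz => rw [Set.mem_singleton_iff.1 hz]; exact hS
    | algebraMap r =>
      intro v hv
      rw [Algebra.algebraMap_eq_smul_one, vecMul_smul, vecMul_one,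
        -- Scalars of `𝔽₃` act as natural multiples, so an additive submonoid is already a subspace.
        show r • v = r.val • v by rw [← Nat.cast_smul_eq_nsmul (ZMod 3), ZMod.natCast_zmod_val]]
      exact nsmul_mem hv _
    | add x y _ _ hx hy => intro v hv; rw [vecMul_add]; exact add_mem (hx v hv) (hy v hv)
    | mul x y _ _ hx hy => intro v hv; rw [← vecMul_vecMul]; exact hy _ (hx v hv)
  rw [← d_vecMul_eq v, ← hd]
  exact key _ (sum_mem_L v) _ (key _ hy _ hw)

/-- A subset of the field `𝔽₃[a]` stable under `a` and containing a unit is everything. -/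
theorem L_le_of_mul_mem (S : AddSubmonoid M4) (hS : ∀ v ∈ S, a * v ∈ S)
    {w : M4} (hw : w ∈ S) {y : M4} (hy : y ∈ L) (h1 : y * w = 1) {v : M4} (hv : v ∈ L) :
    v ∈ S := by
  have key : ∀ z ∈ L, ∀ v ∈ S, z * v ∈ S := by
    intro z hz
    induction hz using Algebra.adjoin_induction with
    | mem z hz => rw [Set.mem_singleton_iff.1 hz]; exact hS
    | algebraMap r =>
      intro v hv
      rw [← Algebra.smul_def,
        show r • v = r.val • v by rw [← Nat.cast_smul_eq_nsmul (ZMod 3), ZMod.natCast_zmod_val]]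
      exact nsmul_mem hv _
    | add x y _ _ hx hy => intro v hv; rw [add_mul]; exact add_mem (hx v hv) (hy v hv)
    | mul x y _ _ hx hy => intro v hv; rw [mul_assoc]; exact hx _ (hy v hv)
  have := key _ (mul_mem hv hy) _ hw
  rwa [mul_assoc, h1, mul_one] at this

/-! ### The block matrices -/

theorem blockMat_mul (r s : Fin 4 → Fin 4 → ZMod 3) (X Y : Matrix (Fin 4) (Fin 4) M4) :
    blockMat r X * blockMat s Y = blockMat (fun j => s j + ∑ i, r i ᵥ* Y i j) (X * Y) := by
  rw [blockMat, blockMat, blockMat, Matrix.fromBlocks_multiply, Matrix.fromBlocks_inj]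
  rw [map_mul]
  refine ⟨by simp, ?_, by simp, by simp⟩
  rw [Matrix.one_mul]
  ext i p
  simp [Matrix.mul_apply, Fintype.sum_prod_type, Matrix.vecMul, dotProduct]

theorem blockMat_inj {r s : Fin 4 → Fin 4 → ZMod 3} {X Y : Matrix (Fin 4) (Fin 4) M4} :
    blockMat r X = blockMat s Y ↔ r = s ∧ X = Y := by
  simp only [blockMat, Matrix.fromBlocks_inj, EmbeddingLike.apply_eq_iff_eq, true_and]
  refine and_congr_left fun _ => ⟨fun h => ?_, fun h => h ▸ rfl⟩
  ext i j
  exact congrFun (congrFun h 0) (i, j)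

/-- The unitriangular `4 × 4` matrices with the shape of the lower right part of `C`. -/
def U {R : Type*} [Ring R] (x y z s t : R) : Matrix (Fin 4) (Fin 4) R :=
  !![1, x, y, z;
     0, 1, 0, s;
     0, 0, 1, t;
     0, 0, 0, 1]

section U

variable {R : Type*} [Ring R]

theorem U_mul_U (x y z s t x' y' z' s' t' : R) :
    U x y z s t * U x' y' z' s' t' =
      U (x + x') (y + y') (z + z' + (x * s' + y * t')) (s + s') (t + t') := by
  ext1 i j
  fin_cases i <;> fin_cases j <;> simp [U, Matrix.mul_apply, Fin.sum_univ_four, add_comm]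
  abel

theorem U_zero : U (0 : R) 0 0 0 0 = 1 := by
  ext1 i j
  fin_cases i <;> fin_cases j <;> simp [U]

theorem U_mul_diagonal (x y z s t u : R) : U x y z s t * Matrix.diagonal (fun _ => u) =
    !![u, x * u, y * u, z * u; 0, u, 0, s * u; 0, 0, u, t * u; 0, 0, 0, u] := by
  ext1 i j
  fin_cases i <;> fin_cases j <;> simp [U, Matrix.mul_diagonal]

theorem diagonal_mul_U (x y z s t u : R) : Matrix.diagonal (fun _ => u) * U x y z s t =
    !![u, u * x, u * y, u * z; 0, u, 0, u * s; 0, 0, u, u * t; 0, 0, 0, u] := by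
  ext1 i j
  fin_cases i <;> fin_cases j <;> simp [U, Matrix.diagonal_mul]

theorem U_congr {x y z s t x' y' z' s' t' : R} (hx : x = x') (hy : y = y') (hz : z = z')
    (hs : s = s') (ht : t = t') : U x y z s t = U x' y' z' s' t' := by
  rw [hx, hy, hz, hs, ht]

theorem U_mul_diagonal_eq {x y z s t x' y' z' s' t' u : R} (hx : x * u = u * x')
    (hy : y * u = u * y') (hz : z * u = u * z') (hs : s * u = u * s') (ht : t * u = u * t') :
    U x y z s t * Matrix.diagonal (fun _ => u) =
      Matrix.diagonal (fun _ => u) * U x' y' z' s' t' := by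
  rw [U_mul_diagonal, diagonal_mul_U, hx, hy, hz, hs, ht]

end U

/-- The block matrices parametrizing the lower right parts of the elements of `P`. -/
def T (x p : M4) : Matrix (Fin 4) (Fin 4) M4 :=
  U (x * b) (sigma (sigma x) * b ^ 2)
    (p * b ^ 3 + (sigma (sigma (sigma p)) + sigma (sigma x) * sigma (sigma (sigma x)) - x) * b)
    (-(sigma (sigma x) * b ^ 2)) (sigma x * b ^ 3)

/-! ### The group law on the parameters x, p -/

theorem T_zero : T 0 0 = 1 := by
  rw [← U_zero, T]
  simp only [map_zero, zero_mul, add_zero, sub_zero, neg_zero]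

theorem mul_b_mul_mul_b_sq (x y : M4) :
    x * b * (sigma (sigma y) * b ^ 2) = x * sigma (sigma (sigma y)) * b ^ 3 := by
  rw [mul_assoc x, ← mul_assoc b, b_mul, pow_succ' b 2]
  simp only [mul_assoc]

theorem mul_b_sq_mul_mul_b_cube (x y : M4) :
    sigma (sigma x) * b ^ 2 * (sigma y * b ^ 3) =
      sigma (sigma x) * sigma (sigma (sigma y)) * b := by
  rw [mul_assoc (sigma _), ← mul_assoc (b ^ 2), b_sq_mul, mul_assoc _ (b ^ 2), ← pow_add,
    show 2 + 3 = 4 + 1 by rfl, pow_add, b_pow, one_mul, pow_one]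
  simp only [mul_assoc]

/-- The top right corner lies in `L b^3 + L b`, and the `b`-coefficient is tied to the
`b^3`-coefficient p. This relation survives multiplication because applying `sigma` three times to
`x * sigma (sigma (sigma y))` gives one of the two cross terms of the quadratic expression in `T`,
while the other cross term is what the matrix product contributes. The summand `-x` is additive,
hence harmless; it makes the corner of `T 1 0` vanish, as it does in `C`. -/
theorem T_mul_T {x p y q : M4} (hx : x ∈ L) (hy : y ∈ L) :
    T x p * T y q = T (x + y) (p + q - x * sigma (sigma (sigma y))) := by
  have e3 : sigma (sigma y) * sigma (sigma (sigma x)) =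
      sigma (sigma (sigma x)) * sigma (sigma y) :=
    L_mul_comm (sigma_mem (sigma_mem hy)) (sigma_mem (sigma_mem (sigma_mem hx)))
  rw [T, T, U_mul_U, T, mul_neg, mul_b_mul_mul_b_sq, mul_b_sq_mul_mul_b_cube]
  refine U_congr ?_ ?_ ?_ ?_ ?_ <;>
    simp only [map_add, map_sub, map_mul, sigma_four, mul_add, add_mul, sub_mul, e3, neg_add]
  abel

/-- The block diagonal matrix `diag(1, x, x, x, x)`. -/
def blockDiag : M4 →* Matrix Idx Idx (ZMod 3) where
  toFun x := blockMat 0 (Matrix.diagonal fun _ => x)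
  map_one' := by rw [Matrix.diagonal_one, blockMat_zero_one]
  map_mul' x y := by rw [blockMat_zero_mul, Matrix.diagonal_mul_diagonal]

theorem blockDiag_apply (x : M4) : blockDiag x = blockMat 0 (Matrix.diagonal fun _ => x) := rfl

theorem blockDiag_injective : Function.Injective blockDiag := fun x y h => by
  have := (blockMat_inj.1 h).2
  simpa using congrFun (congrFun this 0) 0

theorem matA_eq : matA = blockDiag a := rfl

theorem matB_eq : matB = blockDiag b := rfl

theorem blockMat_mul_blockDiag (r : Fin 4 → Fin 4 → ZMod 3) (X : Matrix (Fin 4) (Fin 4) M4)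
    (y : M4) : blockMat r X * blockDiag y =
      blockMat (fun j => r j ᵥ* y) (X * Matrix.diagonal fun _ => y) := by
  rw [blockDiag_apply, blockMat_mul, blockMat_inj]
  refine ⟨?_, rfl⟩
  ext1 j
  rw [Finset.sum_eq_single j (fun i _ hij => by rw [Matrix.diagonal_apply_ne _ hij, vecMul_zero])
    (fun h => absurd (Finset.mem_univ j) h), Matrix.diagonal_apply_eq, Pi.zero_apply, zero_add]

theorem blockDiag_mul_blockMat (r : Fin 4 → Fin 4 → ZMod 3) (X : Matrix (Fin 4) (Fin 4) M4)
    (y : M4) : blockDiag y * blockMat r X = blockMat r ((Matrix.diagonal fun _ => y) * X) := by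
  rw [blockDiag_apply, blockMat_mul, blockMat_inj]
  refine ⟨?_, rfl⟩
  ext1 j
  simp only [Pi.zero_apply, zero_vecMul, Finset.sum_const_zero, add_zero]

/-! ### Conjugation by A and B in terms of the parameters -/

theorem mul_b_pow_mul_a {z : M4} (hz : z ∈ L) :
    z * b * a = a ^ 3 * z * b ∧ z * b ^ 2 * a = a ^ 4 * z * b ^ 2 ∧
      z * b ^ 3 * a = a ^ 2 * z * b ^ 3 := by
  have h2 : b ^ 2 * a = a ^ 4 * b ^ 2 := by decide +kernel
  have h3 : b ^ 3 * a = a ^ 2 * b ^ 3 := by decide +kernel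
  have c : ∀ k, z * a ^ k = a ^ k * z := fun k => L_mul_comm hz (pow_mem a_mem_L k)
  rw [mul_assoc, b_mul_a, mul_assoc z, h2, mul_assoc z, h3, ← mul_assoc, ← mul_assoc, ← mul_assoc,
    c, c, c]
  exact ⟨rfl, rfl, rfl⟩

/-- Moving `a` leftwards past `b^k` raises it to the power `3^k`, and one factor `a` is then split
off. The quadratic term is consistent with this: it acquires the factor `a^12 = a^2`, just as `sigma
(sigma (sigma p))` does. -/
theorem T_mul_diagonal_a {x p : M4} (hx : x ∈ L) (hp : p ∈ L) :
    T x p * Matrix.diagonal (fun _ => a) =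
      Matrix.diagonal (fun _ => a) * T (a ^ 2 * x) (a * p) := by
  have s2 : sigma (sigma a) = a ^ 4 := by
    rw [sigma_a, map_pow, sigma_a]; decide +kernel
  have s3 : sigma (sigma (sigma a)) = a ^ 2 := by
    rw [s2, map_pow, sigma_a]; decide +kernel
  have t1 := sigma_mem hx
  have t2 := sigma_mem t1
  have t3 := sigma_mem t2
  have u3 := sigma_mem (sigma_mem (sigma_mem hp))
  have f1 : a * a ^ 2 = a ^ 3 := by decide +kernel
  have f2 : a * (a ^ 4) ^ 2 = a ^ 4 := by decide +kernel
  have f3 : a * ((a ^ 4) ^ 2 * (a ^ 2) ^ 2) = a ^ 3 := by decide +kernel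
  have f4 : a * (a ^ 3) ^ 2 = a ^ 2 := by decide +kernel
  have f5 : a * a = a ^ 2 := (pow_two a).symm
  refine U_mul_diagonal_eq ?_ ?_ ?_ ?_ ?_
  · rw [(mul_b_pow_mul_a hx).1, ← f1]; simp only [mul_assoc]
  · rw [(mul_b_pow_mul_a t2).2.1, map_mul, map_mul, map_pow, map_pow, s2, ← mul_assoc,
      ← mul_assoc, f2]
  · have hw := sub_mem (add_mem u3 (mul_mem t2 t3)) hx
    have e : sigma (sigma (a ^ 2 * x)) * sigma (sigma (sigma (a ^ 2 * x))) =
        (a ^ 4) ^ 2 * (a ^ 2) ^ 2 * (sigma (sigma x) * sigma (sigma (sigma x))) := by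
      have g2 : sigma (sigma (a ^ 2 * x)) = (a ^ 4) ^ 2 * sigma (sigma x) := by
        rw [map_mul, map_mul, map_pow, map_pow, s2]
      have g3 : sigma ((a ^ 4) ^ 2 * sigma (sigma x)) =
          (a ^ 2) ^ 2 * sigma (sigma (sigma x)) := by
        rw [map_mul, map_pow, ← s2, s3]
      rw [g2, g3, mul_assoc, ← mul_assoc (sigma (sigma x)),
        L_mul_comm t2 (pow_mem (pow_mem a_mem_L 2) 2)]
      simp only [mul_assoc]
    rw [add_mul, (mul_b_pow_mul_a hp).2.2, (mul_b_pow_mul_a hw).1, e]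
    simp only [map_mul, s3, mul_add, mul_sub, ← mul_assoc, f1, f5]
    rw [mul_assoc a, f3]
  · rw [neg_mul, (mul_b_pow_mul_a t2).2.1, map_mul, map_mul, map_pow, map_pow, s2, mul_neg,
      ← mul_assoc, ← mul_assoc, f2]
  · rw [(mul_b_pow_mul_a t1).2.2, map_mul, map_pow, sigma_a, ← mul_assoc, ← mul_assoc, f4]

theorem T_mul_diagonal_b (x p : M4) :
    T x p * Matrix.diagonal (fun _ => b) =
      Matrix.diagonal (fun _ => b) * T (sigma (sigma (sigma x))) (sigma (sigma (sigma p))) := by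
  have e : ∀ (z : M4) k, z * b ^ k * b = b * (sigma (sigma (sigma z)) * b ^ k) := fun z k => by
    rw [← mul_assoc, b_mul, sigma_four, mul_assoc, mul_assoc, ← pow_succ, ← pow_succ']
  have e1 : ∀ z : M4, z * b * b = b * (sigma (sigma (sigma z)) * b) := fun z => by
    simpa only [pow_one] using e z 1
  refine U_mul_diagonal_eq ?_ ?_ ?_ ?_ ?_
  · rw [e1]
  · rw [e]
  · rw [add_mul, e, e1, mul_add]
    simp only [map_sub, map_add, map_mul]
  · rw [neg_mul, e, mul_neg]
  · rw [e]

theorem blockMat_T_mul_matA (r : Fin 4 → Fin 4 → ZMod 3) {x p : M4} (hx : x ∈ L) (hp : p ∈ L) :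
    blockMat r (T x p) * matA = matA * blockMat (fun j => r j ᵥ* a) (T (a ^ 2 * x) (a * p)) := by
  rw [matA_eq, blockMat_mul_blockDiag, blockDiag_mul_blockMat, T_mul_diagonal_a hx hp]

theorem blockMat_T_mul_matB (r : Fin 4 → Fin 4 → ZMod 3) (x p : M4) :
    blockMat r (T x p) * matB = matB * blockMat (fun j => r j ᵥ* b)
      (T (sigma (sigma (sigma x))) (sigma (sigma (sigma p)))) := by
  rw [matB_eq, blockMat_mul_blockDiag, blockDiag_mul_blockMat, T_mul_diagonal_b]

/-! ### Cubes -/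

theorem vec_three_eq_zero (v : Fin 4 → ZMod 3) : v + v + v = 0 := by
  have h : ∀ z : ZMod 3, z + z + z = 0 := by decide
  ext i
  exact h (v i)

theorem row_mul_U (r : Fin 4 → Fin 4 → ZMod 3) (x y z s t : M4) :
    (fun j => ∑ i, r i ᵥ* U x y z s t i j) =
      ![r 0, r 0 ᵥ* x + r 1, r 0 ᵥ* y + r 2, r 0 ᵥ* z + r 1 ᵥ* s + r 2 ᵥ* t + r 3] := by
  ext1 j
  rw [Fin.sum_univ_four]
  fin_cases j <;> simp [U]

theorem blockMat_mul_U (r s : Fin 4 → Fin 4 → ZMod 3) (X : Matrix (Fin 4) (Fin 4) M4)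
    (x y z u t : M4) : blockMat r X * blockMat s (U x y z u t) =
      blockMat (s + ![r 0, r 0 ᵥ* x + r 1, r 0 ᵥ* y + r 2,
        r 0 ᵥ* z + r 1 ᵥ* u + r 2 ᵥ* t + r 3]) (X * U x y z u t) := by
  rw [blockMat_mul, ← row_mul_U]
  rfl

/-- In characteristic 3 the cube of `1 + N` is `1 + N^3`. For this shape the only surviving path of
length three goes from the single index through the first block to the last one. -/
theorem blockMat_U_cube (r : Fin 4 → Fin 4 → ZMod 3) (x y z s t : M4) :
    blockMat r (U x y z s t) ^ 3 =
      blockMat ![0, 0, 0, r 0 ᵥ* (x * s + y * t)] 1 := by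
  rw [pow_succ, pow_two, blockMat_mul_U, blockMat_mul_U, blockMat_inj]
  constructor
  · have h := fun i => vec_three_eq_zero (r i)
    ext1 j
    fin_cases j
    · simpa [add_assoc] using h 0
    · have := vec_three_eq_zero (r 0 ᵥ* x)
      have h1 := h 1
      simp [add_vecMul]
      linear_combination (exp := 1) this + h1
    · have := vec_three_eq_zero (r 0 ᵥ* y)
      have h1 := h 2
      simp [add_vecMul]
      linear_combination (exp := 1) this + h1
    · have e1 := vec_three_eq_zero (r 0 ᵥ* z)
      have e2 := vec_three_eq_zero (r 1 ᵥ* s)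
      have e3 := vec_three_eq_zero (r 2 ᵥ* t)
      have h1 := h 3
      simp [add_vecMul, vecMul_add]
      linear_combination (exp := 1) e1 + e2 + e3 + h1
  · rw [U_mul_U, U_mul_U, ← U_zero]
    refine U_congr (three_eq_zero _) (three_eq_zero _) ?_ (three_eq_zero _) (three_eq_zero _)
    have := three_eq_zero (x * s + y * t)
    have hz := three_eq_zero z
    calc _ = (z + z + z) + (x * s + y * t + (x * s + y * t) + (x * s + y * t)) := by
          rw [add_mul, add_mul]; abel
      _ = 0 := by rw [hz, this, add_zero]

theorem blockMat_T_cube (r : Fin 4 → Fin 4 → ZMod 3) (x p : M4) :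
    blockMat r (T x p) ^ 3 = blockMat ![0, 0, 0,
      r 0 ᵥ* (sigma (sigma x) * sigma (sigma (sigma x)) * b -
        x * sigma (sigma (sigma x)) * b ^ 3)] 1 := by
  rw [T, blockMat_U_cube, mul_neg, mul_b_mul_mul_b_sq, mul_b_sq_mul_mul_b_cube, neg_add_eq_sub]

theorem blockMat_T_pow_nine (r : Fin 4 → Fin 4 → ZMod 3) (x p : M4) :
    blockMat r (T x p) ^ 9 = 1 := by
  rw [show 9 = 3 * 3 by rfl, pow_mul, blockMat_T_cube, ← U_zero, blockMat_U_cube,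
    ← blockMat_zero_one]
  refine blockMat_inj.2 ⟨?_, rfl⟩
  ext1 j
  fin_cases j <;> simp

/-! ### Some units of `𝔽₃[a]` -/

theorem eq_zero_of_left_inv {R : Type*} [Ring R] {x y z : R} (h : y * z = 1) (h0 : z * x = 0) :
    x = 0 := by
  rw [← one_mul x, ← h, mul_assoc, h0, mul_zero]

theorem exists_mul_a_pow_four_sub : ∃ y ∈ L, y * (a ^ 4 - a) = 1 :=
  ⟨_, sum_mem_L ![1, 2, 2, 0], by decide +kernel⟩

theorem exists_mul_a_sq_sub : ∃ y ∈ L, y * (a ^ 2 - a) = 1 :=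
  ⟨_, sum_mem_L ![2, 1, 0, 2], by decide +kernel⟩

theorem exists_a_sub_one_mul : ∃ y, (a - 1) * y = 1 :=
  ⟨∑ i : Fin 4, (![1, 0, 2, 1] : Fin 4 → ZMod 3) i • a ^ (i : ℕ), by decide +kernel⟩

/-! ### Uniqueness of the parameters -/

theorem mul_b_injective {x y : M4} (h : x * b = y * b) : x = y := by
  have := congrArg (· * b ^ 3) h
  simpa only [mul_assoc, b_mul_b_pow_three, mul_one] using this

/-- Equal corners put `(p - q) b^2` into `L`, where it commutes with `a`; but moving `a` past `b^2`
turns it into `a^4`. As `a^4 - a` is a unit, `p - q` must vanish. -/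
theorem T_injOn {x y p q : M4} (hp : p ∈ L) (hq : q ∈ L)
    (h : T x p = T y q) : x = y ∧ p = q := by
  have h1 : x * b = y * b := congrFun (congrFun h 0) 1
  obtain rfl := mul_b_injective h1
  refine ⟨rfl, ?_⟩
  have h3 : p * b ^ 3 +
      (sigma (sigma (sigma p)) + sigma (sigma x) * sigma (sigma (sigma x)) - x) * b =
      q * b ^ 3 +
      (sigma (sigma (sigma q)) + sigma (sigma x) * sigma (sigma (sigma x)) - x) * b :=
      congrFun (congrFun h 0) 3
  have hz : p - q ∈ L := sub_mem hp hq
  have h4 : (p - q) * b ^ 2 = -sigma (sigma (sigma (p - q))) := by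
    apply mul_b_injective
    rw [mul_assoc, ← pow_succ, ← sub_eq_zero]
    rw [← sub_eq_zero] at h3
    rw [← h3]
    simp only [map_sub, sub_mul, add_mul, neg_mul]
    abel
  have h5 : (p - q) * b ^ 2 ∈ L := h4 ▸ neg_mem (sigma_mem (sigma_mem (sigma_mem hz)))
  have h6 := (mul_b_pow_mul_a hz).2.1
  rw [L_mul_comm h5 a_mem_L, mul_assoc, ← sub_eq_zero, ← sub_mul] at h6
  obtain ⟨y, -, hy⟩ := exists_mul_a_pow_four_sub
  have h7 := eq_zero_of_left_inv (x := (p - q) * b ^ 2) hy (by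
    rw [← neg_eq_zero, ← neg_mul, neg_sub, h6])
  rw [← sub_eq_zero, ← mul_one (p - q), ← b_pow, pow_add b 2 2, ← mul_assoc, h7, zero_mul]

/-! ### The group of block matrices -/

/-- The monoid of the block matrices that make up `P`. -/
def blockMonoid : Submonoid (Matrix Idx Idx (ZMod 3)) where
  carrier := {M | ∃ r, ∃ x ∈ L, ∃ p ∈ L, M = blockMat r (T x p)}
  one_mem' := ⟨0, 0, L.zero_mem, 0, L.zero_mem, by rw [T_zero, blockMat_zero_one]⟩
  mul_mem' := by
    rintro g h ⟨r, x, hx, p, hp, rfl⟩ ⟨s, y, hy, q, hq, rfl⟩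
    exact ⟨_, _, add_mem hx hy, _, sub_mem (add_mem hp hq)
      (mul_mem hx (sigma_mem (sigma_mem (sigma_mem hy)))), by rw [blockMat_mul, T_mul_T hx hy]⟩

theorem blockMonoid_pow_nine {M : Matrix Idx Idx (ZMod 3)} (hM : M ∈ blockMonoid) : M ^ 9 = 1 := by
  obtain ⟨r, x, -, p, -, rfl⟩ := hM
  exact blockMat_T_pow_nine r x p

/-- The subgroup `P`, as a group of matrices given by explicit block matrices. -/
def blockGroup : Subgroup (GL Idx (ZMod 3)) where
  __ := blockMonoid.comap (Units.coeHom _)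
  inv_mem' := by
    intro g hg
    -- Exponent 9 makes the monoid closed under inverses.
    have h8 : g⁻¹ = g ^ 8 := by
      rw [inv_eq_iff_mul_eq_one, ← pow_succ']
      exact Units.ext (blockMonoid_pow_nine hg)
    rw [h8]
    exact Submonoid.pow_mem (blockMonoid.comap (Units.coeHom _)) hg 8

theorem mem_blockGroup {g : GL Idx (ZMod 3)} :
    g ∈ blockGroup ↔ (g : Matrix Idx Idx (ZMod 3)) ∈ blockMonoid := Iff.rfl

theorem blockGroup_pow_nine {g : GL Idx (ZMod 3)} (hg : g ∈ blockGroup) : g ^ 9 = 1 :=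
  Units.ext (blockMonoid_pow_nine hg)

/-- The coordinates on `P`. -/
noncomputable def blockGroupEquiv : blockGroup ≃ (Fin 4 → Fin 4 → ZMod 3) × L × L := by
  symm
  refine Equiv.ofBijective (fun q => ⟨Units.ofPowEqOne (blockMat q.1 (T q.2.1 q.2.2)) 9
    (blockMat_T_pow_nine _ _ _) (by norm_num), q.1, _, q.2.1.2, _, q.2.2.2, rfl⟩) ⟨?_, ?_⟩
  · rintro ⟨r, x, p⟩ ⟨s, y, q⟩ h
    have h := congrArg (fun g : blockGroup => ((g : GL Idx (ZMod 3)) : Matrix Idx Idx (ZMod 3))) h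
    obtain ⟨rfl, h⟩ := blockMat_inj.1 h
    obtain ⟨hx, hp⟩ := T_injOn p.2 q.2 h
    exact congrArg (Prod.mk r) (Prod.ext (Subtype.ext hx) (Subtype.ext hp))
  · rintro ⟨g, r, x, hx, p, hp, hg⟩
    exact ⟨⟨r, ⟨x, hx⟩, ⟨p, hp⟩⟩, Subtype.ext (Units.ext hg.symm)⟩

theorem card_blockGroup : Nat.card blockGroup = 3 ^ 24 := by
  rw [Nat.card_congr blockGroupEquiv, Nat.card_prod, Nat.card_prod, Nat.card_congr firstRowEquiv]
  simp [Nat.card_eq_fintype_card]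

theorem mul_blockMonoid_matA {M : Matrix Idx Idx (ZMod 3)} (hM : M ∈ blockMonoid) :
    ∃ N ∈ blockMonoid, M * matA = matA * N := by
  obtain ⟨r, x, hx, p, hp, rfl⟩ := hM
  exact ⟨_, ⟨_, _, mul_mem (pow_mem a_mem_L 2) hx, _, mul_mem a_mem_L hp, rfl⟩,
    blockMat_T_mul_matA r hx hp⟩

theorem mul_blockMonoid_matB {M : Matrix Idx Idx (ZMod 3)} (hM : M ∈ blockMonoid) :
    ∃ N ∈ blockMonoid, M * matB = matB * N := by
  obtain ⟨r, x, hx, p, hp, rfl⟩ := hM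
  exact ⟨_, ⟨_, _, sigma_mem (sigma_mem (sigma_mem hx)), _, sigma_mem (sigma_mem (sigma_mem hp)),
    rfl⟩, blockMat_T_mul_matB r x p⟩

/-- The parameter formulas describe conjugation by the inverse of `A`; by finiteness, mapping the
group into itself is enough to normalize it. -/
theorem uA_mem_normalizer : uA ∈ Subgroup.normalizer (blockGroup : Set (GL Idx (ZMod 3))) := by
  rw [← inv_inv uA]
  refine inv_mem (Subgroup.mem_normalizer_fintype fun n hn => ?_)
  obtain ⟨N, hN, h⟩ := mul_blockMonoid_matA (mem_blockGroup.1 hn)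
  rw [inv_inv, mul_assoc]
  change ((uA⁻¹ * (n * uA) : GL Idx (ZMod 3)) : Matrix Idx Idx (ZMod 3)) ∈ blockMonoid
  rw [Units.val_mul, Units.val_mul, show (uA : Matrix Idx Idx (ZMod 3)) = matA from rfl, h]
  rwa [show matA * N = uA * N from rfl, Units.inv_mul_cancel_left]

theorem uB_mem_normalizer : uB ∈ Subgroup.normalizer (blockGroup : Set (GL Idx (ZMod 3))) := by
  rw [← inv_inv uB]
  refine inv_mem (Subgroup.mem_normalizer_fintype fun n hn => ?_)
  obtain ⟨N, hN, h⟩ := mul_blockMonoid_matB (mem_blockGroup.1 hn)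
  rw [inv_inv, mul_assoc]
  change ((uB⁻¹ * (n * uB) : GL Idx (ZMod 3)) : Matrix Idx Idx (ZMod 3)) ∈ blockMonoid
  rw [Units.val_mul, Units.val_mul, show (uB : Matrix Idx Idx (ZMod 3)) = matB from rfl, h]
  rwa [show matB * N = uB * N from rfl, Units.inv_mul_cancel_left]

theorem matC_eq : matC = blockMat 0 (T 1 0) := by
  refine blockMat_inj.2 ⟨rfl, ?_⟩
  change U c1 c3 0 c4 c2 = _
  refine U_congr ?_ ?_ ?_ ?_ ?_ <;> simp [c1, c2, c3, c4]

theorem uC_mem_blockGroup : uC ∈ blockGroup :=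
  ⟨0, 1, L.one_mem, 0, L.zero_mem, matC_eq⟩

theorem uD_mem_blockGroup : uD ∈ blockGroup :=
  ⟨![d, 0, 0, 0], 0, L.zero_mem, 0, L.zero_mem, by rw [T_zero]; rfl⟩

/-! ### Generation -/

section Generation

/-- The matrices of the elements of a subgroup. -/
def matrices (K : Subgroup (GL Idx (ZMod 3))) : Submonoid (Matrix Idx Idx (ZMod 3)) :=
  K.toSubmonoid.map (Units.coeHom _)

variable {K : Subgroup (GL Idx (ZMod 3))}

theorem coe_mem_matrices {g : GL Idx (ZMod 3)} (hg : g ∈ K) :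
    (g : Matrix Idx Idx (ZMod 3)) ∈ matrices K := ⟨g, hg, rfl⟩

theorem mem_of_coe_mem_matrices {g : GL Idx (ZMod 3)}
    (hg : (g : Matrix Idx Idx (ZMod 3)) ∈ matrices K) : g ∈ K := by
  obtain ⟨k, hk, h⟩ := hg
  rwa [← Units.ext h]

theorem matrices_of_mul_eq {M N N' : Matrix Idx Idx (ZMod 3)} (hM : M ∈ matrices K)
    (hN : N ∈ matrices K) (h : M * N' = N) : N' ∈ matrices K := by
  obtain ⟨m, hm, rfl⟩ := hM
  obtain ⟨n, hn, rfl⟩ := hN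
  refine ⟨m⁻¹ * n, K.mul_mem (K.inv_mem hm) hn, ?_⟩
  rw [map_mul, ← h]
  exact Units.inv_mul_cancel_left m N'

theorem matrices_of_conj (hA : ∀ k ∈ K, uA⁻¹ * k * uA ∈ K) {M N : Matrix Idx Idx (ZMod 3)}
    (hM : M ∈ matrices K) (h : M * matA = matA * N) : N ∈ matrices K := by
  obtain ⟨m, hm, rfl⟩ := hM
  refine ⟨_, hA m hm, ?_⟩
  rw [mul_assoc, map_mul, map_mul]
  change ((uA⁻¹ : GL Idx (ZMod 3)) : Matrix Idx Idx (ZMod 3)) *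
    ((m : Matrix Idx Idx (ZMod 3)) * matA) = N
  change (m : Matrix Idx Idx (ZMod 3)) * matA = matA * N at h
  rw [h]
  exact Units.inv_mul_cancel_left uA N

theorem blockMat_zero_one_mem_matrices : blockMat 0 1 ∈ matrices K := by
  rw [blockMat_zero_one]
  exact (matrices K).one_mem

theorem blockMat_add_mem_matrices {r s : Fin 4 → Fin 4 → ZMod 3}
    (hr : blockMat r 1 ∈ matrices K) (hs : blockMat s 1 ∈ matrices K) :
    blockMat (r + s) 1 ∈ matrices K := by
  rw [← blockMat_row_mul]
  exact (matrices K).mul_mem hr hs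

theorem blockMat_neg_mem_matrices {r : Fin 4 → Fin 4 → ZMod 3}
    (hr : blockMat r 1 ∈ matrices K) : blockMat (-r) 1 ∈ matrices K := by
  refine matrices_of_mul_eq hr (matrices K).one_mem ?_
  rw [blockMat_row_mul, add_neg_cancel, blockMat_zero_one]

variable (K) in
/-- The rows of the elements of a subgroup with trivial lower right part. -/
def rows : AddSubgroup (Fin 4 → Fin 4 → ZMod 3) where
  carrier := {r | blockMat r 1 ∈ matrices K}
  zero_mem' := blockMat_zero_one_mem_matrices
  add_mem' := blockMat_add_mem_matrices
  neg_mem' := blockMat_neg_mem_matrices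

theorem mem_rows {r : Fin 4 → Fin 4 → ZMod 3} : r ∈ rows K ↔ blockMat r 1 ∈ matrices K := Iff.rfl

theorem rows_vecMul_a (hA : ∀ k ∈ K, uA⁻¹ * k * uA ∈ K) {r : Fin 4 → Fin 4 → ZMod 3}
    (hr : r ∈ rows K) : (fun j => r j ᵥ* a) ∈ rows K := by
  refine matrices_of_conj hA hr ?_
  rw [matA_eq, blockMat_mul_blockDiag, blockDiag_mul_blockMat, one_mul, mul_one]

/-- Conjugating a matrix with trivial lower right part by `blockMat 0 X` multiplies its row by `X`.
-/
theorem rows_mul {r : Fin 4 → Fin 4 → ZMod 3} {X : Matrix (Fin 4) (Fin 4) M4} (hr : r ∈ rows K)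
    (hX : blockMat 0 X ∈ matrices K) : (fun j => ∑ i, r i ᵥ* X i j) ∈ rows K := by
  refine matrices_of_mul_eq hX (mul_mem hr hX) ?_
  rw [blockMat_mul, blockMat_mul, blockMat_inj, one_mul, mul_one]
  refine ⟨?_, rfl⟩
  ext1 j
  simp only [Pi.zero_apply, zero_vecMul, Finset.sum_const_zero, add_zero, zero_add]

/-- A position is full as soon as it contains a generator of the module of row vectors. -/
theorem single_mem_rows (hA : ∀ k ∈ K, uA⁻¹ * k * uA ∈ K) {j : Fin 4} {w : Fin 4 → ZMod 3}
    (hw : Pi.single j w ∈ rows K) {y : M4} (hy : y ∈ L) (hd : w ᵥ* y = d)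
    (v : Fin 4 → ZMod 3) : Pi.single j v ∈ rows K := by
  refine vec_eq_top ((rows K).comap
    (AddMonoidHom.single (fun _ : Fin 4 => Fin 4 → ZMod 3) j)).toAddSubmonoid
    (fun v hv => ?_) hw hy hd v
  have h := rows_vecMul_a hA (r := Pi.single j v) hv
  change Pi.single j (v ᵥ* a) ∈ rows K
  convert h using 1
  ext1 i
  obtain rfl | hij := eq_or_ne i j
  · simp
  · simp [hij]

theorem T_zero_left_mul {p q : M4} : T 0 p * T 0 q = T 0 (p + q) := by
  rw [T_mul_T L.zero_mem L.zero_mem, zero_mul, sub_zero, add_zero]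

theorem blockMat_T_zero_mem_matrices : blockMat 0 (T 0 0) ∈ matrices K := by
  rw [T_zero]
  exact blockMat_zero_one_mem_matrices

theorem blockMat_T_mul_mem_matrices {x p y q : M4} (hx : x ∈ L) (hy : y ∈ L)
    (h : blockMat 0 (T x p) ∈ matrices K) (h' : blockMat 0 (T y q) ∈ matrices K) :
    blockMat 0 (T (x + y) (p + q - x * sigma (sigma (sigma y)))) ∈ matrices K := by
  rw [← T_mul_T hx hy, ← blockMat_zero_mul]
  exact (matrices K).mul_mem h h'

theorem blockMat_T_add_mem_matrices {p q : M4} (h : blockMat 0 (T 0 p) ∈ matrices K)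
    (h' : blockMat 0 (T 0 q) ∈ matrices K) : blockMat 0 (T 0 (p + q)) ∈ matrices K := by
  rw [← T_zero_left_mul, ← blockMat_zero_mul]
  exact (matrices K).mul_mem h h'

variable (K) in
/-- The first parameters of the block matrices in a subgroup. -/
def firstParameters : AddSubmonoid M4 where
  carrier := {x | x ∈ L ∧ ∃ p ∈ L, blockMat 0 (T x p) ∈ matrices K}
  zero_mem' := ⟨L.zero_mem, 0, L.zero_mem, blockMat_T_zero_mem_matrices⟩
  add_mem' := fun ⟨hx, _, hp, h⟩ ⟨hy, _, hq, h'⟩ => ⟨add_mem hx hy, _, sub_mem (add_mem hp hq)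
    (mul_mem hx (sigma_mem (sigma_mem (sigma_mem hy)))), blockMat_T_mul_mem_matrices hx hy h h'⟩

theorem mem_firstParameters {x : M4} :
    x ∈ firstParameters K ↔ x ∈ L ∧ ∃ p ∈ L, blockMat 0 (T x p) ∈ matrices K := Iff.rfl

variable (K) in
/-- The second parameters of the block matrices in a subgroup whose first parameter is zero. -/
def secondParameters : AddSubmonoid M4 where
  carrier := {p | p ∈ L ∧ blockMat 0 (T 0 p) ∈ matrices K}
  zero_mem' := ⟨L.zero_mem, blockMat_T_zero_mem_matrices⟩
  add_mem' := fun ⟨hp, h⟩ ⟨hq, h'⟩ => ⟨add_mem hp hq, blockMat_T_add_mem_matrices h h'⟩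

theorem mem_secondParameters {p : M4} :
    p ∈ secondParameters K ↔ p ∈ L ∧ blockMat 0 (T 0 p) ∈ matrices K := Iff.rfl

theorem blockMat_T_conj_mem (hA : ∀ k ∈ K, uA⁻¹ * k * uA ∈ K) {x p : M4}
    (hx : x ∈ L) (hp : p ∈ L) (h : blockMat 0 (T x p) ∈ matrices K) :
    blockMat 0 (T (a ^ 2 * x) (a * p)) ∈ matrices K := by
  refine matrices_of_conj hA h ?_
  rw [blockMat_T_mul_matA 0 hx hp]
  simp only [Pi.zero_apply, zero_vecMul]
  rfl

theorem mem_firstParameters_of_mem (hC : uC ∈ K) (hA : ∀ k ∈ K, uA⁻¹ * k * uA ∈ K) {x : M4}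
    (hx : x ∈ L) : x ∈ firstParameters K := by
  have hS : ∀ x ∈ firstParameters K, a ^ 2 * x ∈ firstParameters K := fun x h => by
    obtain ⟨hx, p, hp, h⟩ := mem_firstParameters.1 h
    exact mem_firstParameters.2 ⟨mul_mem (pow_mem a_mem_L 2) hx, _, mul_mem a_mem_L hp,
      blockMat_T_conj_mem hA hx hp h⟩
  have h1 : (1 : M4) ∈ firstParameters K :=
    mem_firstParameters.2 ⟨L.one_mem, 0, L.zero_mem, matC_eq ▸ coe_mem_matrices hC⟩
  refine L_le_of_mul_mem _ (fun v hv => ?_) h1 L.one_mem (mul_one 1) hx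
  -- Three multiplications by `a^2` amount to one by `a`, because `a^6 = a`.
  have h := hS _ (hS _ (hS _ hv))
  rwa [← mul_assoc, ← mul_assoc, ← pow_add, ← pow_add, pow_succ, a_pow, one_mul] at h

/-- The commutator of elements with first parameters 1 and `a`: the twisted term in the product
formula is `a^2` in one order and `a` in the other. -/
theorem sub_mem_secondParameters (hC : uC ∈ K) (hA : ∀ k ∈ K, uA⁻¹ * k * uA ∈ K) :
    a ^ 2 - a ∈ secondParameters K := by
  refine mem_secondParameters.2 ⟨sub_mem (pow_mem a_mem_L 2) a_mem_L, ?_⟩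
  obtain ⟨-, p, hp, h⟩ := mem_firstParameters.1 (mem_firstParameters_of_mem hC hA a_mem_L)
  obtain ⟨-, q, hq, h'⟩ := mem_firstParameters.1 (mem_firstParameters_of_mem hC hA L.one_mem)
  have s3 : sigma (sigma (sigma a)) = a ^ 2 := by
    rw [sigma_a, map_pow, sigma_a, map_pow, map_pow, sigma_a]; decide +kernel
  refine matrices_of_mul_eq (mul_mem h' h) (mul_mem h h') ?_
  rw [blockMat_zero_mul, blockMat_zero_mul, blockMat_zero_mul, T_mul_T L.one_mem a_mem_L,
    T_mul_T a_mem_L L.one_mem, T_mul_T (add_mem L.one_mem a_mem_L) L.zero_mem, map_zero, map_zero,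
    map_zero, map_one, map_one, map_one, s3, mul_zero, one_mul, mul_one, add_zero, sub_zero,
    add_comm 1 a, show q + p - a ^ 2 + (a ^ 2 - a) = p + q - a by abel]

theorem blockMat_T_mem_matrices (hC : uC ∈ K) (hA : ∀ k ∈ K, uA⁻¹ * k * uA ∈ K) {x p : M4}
    (hx : x ∈ L) (hp : p ∈ L) : blockMat 0 (T x p) ∈ matrices K := by
  have hS : ∀ p ∈ secondParameters K, a * p ∈ secondParameters K := fun p h => by
    obtain ⟨hp, h⟩ := mem_secondParameters.1 h
    refine mem_secondParameters.2 ⟨mul_mem a_mem_L hp, ?_⟩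
    have := blockMat_T_conj_mem hA L.zero_mem hp h
    rwa [mul_zero] at this
  obtain ⟨y, hy, hy1⟩ := exists_mul_a_sq_sub
  obtain ⟨-, q, hq, h⟩ := mem_firstParameters.1 (mem_firstParameters_of_mem hC hA hx)
  have h0 := (mem_secondParameters.1 (L_le_of_mul_mem _ hS (sub_mem_secondParameters hC hA) hy hy1
    (sub_mem hp hq))).2
  have := mul_mem h h0
  rwa [blockMat_zero_mul, T_mul_T hx L.zero_mem, map_zero, map_zero, map_zero, mul_zero, sub_zero,
    add_zero, add_sub_cancel] at this

theorem blockGroup_le (hC : uC ∈ K) (hD : uD ∈ K) (hA : ∀ k ∈ K, uA⁻¹ * k * uA ∈ K) :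
    blockGroup ≤ K := by
  have hT : ∀ {x p : M4}, x ∈ L → p ∈ L → blockMat 0 (T x p) ∈ matrices K :=
    blockMat_T_mem_matrices hC hA
  have h0 : ∀ v, Pi.single 0 v ∈ rows K := by
    refine single_mem_rows hA (w := d) ?_ L.one_mem (vecMul_one d)
    have : ![d, 0, 0, 0] ∈ rows K := coe_mem_matrices hD
    convert this using 1
    decide +kernel
  have hrow : ∀ v {x p : M4}, x ∈ L → p ∈ L → ![0, v ᵥ* (x * b), v ᵥ* (sigma (sigma x) * b ^ 2),
      v ᵥ* (p * b ^ 3 + (sigma (sigma (sigma p)) + sigma (sigma x) * sigma (sigma (sigma x)) - x)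
        * b)] ∈ rows K := by
    intro v x p hx hp
    -- Commutators of rows concentrated in position 0 with the matrices `T x p`.
    have h := sub_mem (rows_mul (h0 v) (hT hx hp)) (h0 v)
    rw [T, row_mul_U] at h
    convert h using 1
    ext1 j
    fin_cases j <;> simp
  have h3 : ∀ v, Pi.single 3 v ∈ rows K := by
    -- With x = 0 and p = 1 only the last position remains. As `d b = d`, the vector is `2d = -d`,
    -- whence the witness -1.
    refine single_mem_rows hA (w := d ᵥ* (b ^ 3 + b)) ?_ (L.neg_mem L.one_mem)
      (by decide +kernel)
    have h := hrow d L.zero_mem L.one_mem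
    convert h using 1
    ext1 j
    fin_cases j <;> simp
  have h12 : ∀ v {x : M4}, x ∈ L →
      ![0, v ᵥ* (x * b), v ᵥ* (sigma (sigma x) * b ^ 2), 0] ∈ rows K := by
    intro v x hx
    have aux : ∀ u₁ u₂ u₃, ![0, u₁, u₂, u₃] ∈ rows K → ![0, u₁, u₂, 0] ∈ rows K := by
      intro u₁ u₂ u₃ h
      convert sub_mem h (h3 u₃) using 1
      ext1 j
      fin_cases j <;> simp
    exact aux _ _ _ (hrow v hx L.zero_mem)
  have h2 : ∀ v, Pi.single 2 v ∈ rows K := by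
    -- The choices x = 1, v = d and x = a, v = d a^4 agree in position 1, because `a^4 a = 1`, but
    -- differ in position 2.
    refine single_mem_rows hA (w := d ᵥ* b ^ 2 - (d ᵥ* a ^ 4) ᵥ* (a ^ 4 * b ^ 2)) ?_
      (sum_mem_L ![1, 1, 2, 2]) (by decide +kernel)
    have s2 : sigma (sigma a) = a ^ 4 := by
      rw [sigma_a, map_pow, sigma_a]; decide +kernel
    have h := sub_mem (h12 d L.one_mem) (h12 (d ᵥ* a ^ 4) a_mem_L)
    rw [map_one, map_one, one_mul, one_mul, s2] at h
    convert h using 1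
    decide +kernel
  have h1 : ∀ v, Pi.single 1 v ∈ rows K := by
    refine single_mem_rows hA (w := d) ?_ L.one_mem (vecMul_one d)
    have h := sub_mem (h12 d L.one_mem) (h2 (d ᵥ* b ^ 2))
    rw [map_one, map_one, one_mul, one_mul] at h
    convert h using 1
    decide +kernel
  have hR : ∀ r, r ∈ rows K := fun r => by
    rw [← Finset.univ_sum_single r]
    refine sum_mem fun i _ => ?_
    fin_cases i
    · exact h0 _
    · exact h1 _
    · exact h2 _
    · exact h3 _
  rintro g ⟨r, x, hx, p, hp, hg⟩
  apply mem_of_coe_mem_matrices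
  change Units.coeHom _ g ∈ _
  rw [hg]
  have h := mul_mem (hT hx hp) (mem_rows.1 (hR r))
  rw [blockMat_mul, mul_one] at h
  simpa using h

end Generation

/-! ### Cosets of `P` -/

/-- The map sending p to `p (t p⁻¹ t⁻¹)` is injective on `H` by absence of fixed points, hence
surjective by finiteness. -/
theorem exists_mul_eq_conj {Γ : Type*} [Group Γ] {H : Subgroup Γ} [Finite H] {t : Γ}
    (ht : t ∈ Subgroup.normalizer (H : Set Γ)) (hfix : ∀ h ∈ H, h * t = t * h → h = 1) {q : Γ}
    (hq : q ∈ H) : ∃ p ∈ H, q * t = p * t * p⁻¹ := by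
  let f : H → H := fun p => ⟨p * (t * (p : Γ)⁻¹ * t⁻¹),
    H.mul_mem p.2 ((Subgroup.mem_normalizer_iff.1 ht _).1 (H.inv_mem p.2))⟩
  have hf : Function.Injective f := by
    rintro ⟨p, hp⟩ ⟨s, hs⟩ h
    have h1 : p * (t * p⁻¹ * t⁻¹) = s * (t * s⁻¹ * t⁻¹) := congrArg Subtype.val h
    have h2 := hfix (s⁻¹ * p) (H.mul_mem (H.inv_mem hs) hp) (by
      calc s⁻¹ * p * t = s⁻¹ * (p * (t * p⁻¹ * t⁻¹)) * (t * p) := by simp [mul_assoc]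
        _ = t * (s⁻¹ * p) := by rw [h1]; simp [mul_assoc])
    exact Subtype.ext (inv_mul_eq_one.1 h2).symm
  obtain ⟨⟨p, hp⟩, h⟩ := Finite.surjective_of_injective hf ⟨q, hq⟩
  refine ⟨p, hp, ?_⟩
  have h1 : p * (t * p⁻¹ * t⁻¹) = q := congrArg Subtype.val h
  rw [← h1]
  simp [mul_assoc]

instance : Finite blockGroup := Subtype.finite

theorem uA_val : (uA : Matrix Idx Idx (ZMod 3)) = blockDiag a := rfl

theorem uB_val : (uB : Matrix Idx Idx (ZMod 3)) = blockDiag b := rfl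

theorem uA_pow_five : uA ^ 5 = 1 := by
  apply Units.ext
  rw [Units.val_pow_eq_pow_val]
  change matA ^ 5 = 1
  rw [matA_eq, ← map_pow, a_pow, map_one]

theorem uB_pow_four : uB ^ 4 = 1 := by
  apply Units.ext
  rw [Units.val_pow_eq_pow_val]
  change matB ^ 4 = 1
  rw [matB_eq, ← map_pow, b_pow, map_one]

theorem blockDiag_a_mul_cancel {M N : Matrix Idx Idx (ZMod 3)}
    (h : blockDiag a * M = blockDiag a * N) : M = N := by
  have := congrArg (blockDiag (a ^ 4) * ·) h
  simpa only [← mul_assoc, ← map_mul, ← pow_succ, Nat.reduceAdd, a_pow, map_one, one_mul] using this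

theorem eq_one_of_mul_uA {g : GL Idx (ZMod 3)} (hg : g ∈ blockGroup) (h : g * uA = uA * g) :
    g = 1 := by
  obtain ⟨r, x, hx, p, hp, hM⟩ := mem_blockGroup.1 hg
  have h1 : blockMat (fun j => r j ᵥ* a) (T (a ^ 2 * x) (a * p)) = blockMat r (T x p) := by
    have e := congrArg Units.val h
    rw [Units.val_mul, Units.val_mul, uA_val, ← matA_eq, hM, blockMat_T_mul_matA r hx hp,
      matA_eq] at e
    exact blockDiag_a_mul_cancel e
  obtain ⟨hr, hT⟩ := blockMat_inj.1 h1
  obtain ⟨hx1, hp1⟩ := T_injOn (mul_mem a_mem_L hp) hp hT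
  obtain ⟨y, hy⟩ := exists_a_sub_one_mul
  have cancel : ∀ z : M4, a * z = z → z = 0 := fun z hz =>
    eq_zero_of_left_inv (mul_eq_one_comm.1 hy) (by rw [sub_mul, one_mul, hz, sub_self])
  have hx0 : x = 0 := cancel x (by
    have : a ^ 2 * (a ^ 2 * (a ^ 2 * x)) = x := by rw [hx1, hx1, hx1]
    rwa [← mul_assoc, ← mul_assoc, ← pow_add, ← pow_add, pow_succ, a_pow, one_mul] at this)
  have hr0 : r = 0 := by
    ext1 j
    have h2 : r j ᵥ* (a - 1) = 0 := by
      rw [vecMul_sub, vecMul_one, sub_eq_zero]; exact congrFun hr j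
    rw [Pi.zero_apply, ← vecMul_one (r j), ← hy, ← vecMul_vecMul, h2, zero_vecMul]
  apply Units.ext
  rw [hM, hx0, hr0, cancel p hp1, T_zero, blockMat_zero_one, Units.val_one]

theorem mul_uA_pow_pow_five {q : GL Idx (ZMod 3)} (hq : q ∈ blockGroup) {i : ℕ} (hi : i < 5)
    (h0 : i ≠ 0) : (q * uA ^ i) ^ 5 = 1 := by
  -- By Fermat `i^4` is 1 modulo 5, so whatever centralizes `A^i` centralizes `A`.
  have h1 : (uA ^ i) ^ (i ^ 3) = uA := by
    have : ∀ k, uA ^ (5 * k + 1) = uA := fun k => by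
      rw [pow_succ, pow_mul, uA_pow_five, one_pow, one_mul]
    rw [← pow_mul]
    interval_cases i
    · exact absurd rfl h0
    · exact this 0
    · exact this 3
    · exact this 16
    · exact this 51
  obtain ⟨p, -, h⟩ := exists_mul_eq_conj (pow_mem uA_mem_normalizer i) (fun g hg h =>
    eq_one_of_mul_uA hg (h1 ▸ (Commute.pow_right h (i ^ 3) : Commute g _))) hq
  rw [h, conj_pow, ← pow_mul, mul_comm, pow_mul, uA_pow_five, one_pow, mul_one, mul_inv_cancel]

/-- The square lies in `P`, with first parameter y = x + σ²x fixed by σ² (σ being `sigma`) and with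
row block 0 in the image of `b^2 + 1`. The cube formula then gives `r 0 (b^2 + 1) yσ(y) (b - b^3)`.
As yσ(y) is fixed by σ, it commutes with `b^2`, and `(b^2 + 1)(b - b^3) = b - b^5 = 0`. -/
theorem mul_uB_sq_pow_six {q : GL Idx (ZMod 3)} (hq : q ∈ blockGroup) : (q * uB ^ 2) ^ 6 = 1 := by
  obtain ⟨r, x, hx, p, hp, hM⟩ := mem_blockGroup.1 hq
  set M : Matrix Idx Idx (ZMod 3) := blockMat r (T x p)
  -- The second parameter does not enter the cube formula, so its value need not be recorded.
  obtain ⟨p', hp', hM'⟩ : ∃ p' ∈ L, M * matB ^ 2 =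
      matB ^ 2 * blockMat (fun j => r j ᵥ* b ᵥ* b) (T (sigma (sigma x)) p') := by
    refine ⟨_, sigma_mem (sigma_mem (sigma_mem (sigma_mem (sigma_mem (sigma_mem hp))))), ?_⟩
    rw [pow_two, ← mul_assoc, blockMat_T_mul_matB, mul_assoc, blockMat_T_mul_matB, mul_assoc,
      sigma_four]
  have hsq : (q * uB ^ 2 : GL Idx (ZMod 3)).val ^ 2 =
      M * blockMat (fun j => r j ᵥ* b ᵥ* b) (T (sigma (sigma x)) p') := by
    have hB : matB ^ 2 * matB ^ 2 = 1 := by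
      rw [matB_eq, ← map_pow, ← map_mul, ← pow_add, b_pow, map_one]
    have hv : (q * uB ^ 2 : GL Idx (ZMod 3)).val = M * matB ^ 2 := by
      rw [Units.val_mul, hM]; rfl
    rw [hv, pow_two]
    nth_rewrite 2 [hM']
    rw [mul_assoc, ← mul_assoc (matB ^ 2), hB, one_mul]
  have hy : sigma (sigma (x + sigma (sigma x))) = x + sigma (sigma x) := by
    rw [map_add, map_add, sigma_four, add_comm]
  set y := x + sigma (sigma x)
  have hyL : y ∈ L := add_mem hx (sigma_mem (sigma_mem hx))
  have hn : sigma (y * sigma y) = y * sigma y := by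
    rw [map_mul, hy, L_mul_comm hyL (sigma_mem hyL)]
  apply Units.ext
  rw [Units.val_pow_eq_pow_val, show 6 = 2 * 3 by rfl, pow_mul, hsq]
  have hprod : M * blockMat (fun j => r j ᵥ* b ᵥ* b) (T (sigma (sigma x)) p') =
      blockMat (fun j => r j ᵥ* b ᵥ* b + ∑ i, r i ᵥ* T (sigma (sigma x)) p' i j)
        (T y (p + p' - x * sigma (sigma (sigma (sigma (sigma x)))))) := by
    rw [blockMat_mul, T_mul_T hx (sigma_mem (sigma_mem hx))]
  have h0 : r 0 ᵥ* b ᵥ* b + ∑ i, r i ᵥ* T (sigma (sigma x)) p' i 0 =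
      r 0 ᵥ* (b ^ 2 + 1) := by
    have := congrFun (row_mul_U r (sigma (sigma x) * b) (sigma (sigma (sigma (sigma x))) * b ^ 2)
      (p' * b ^ 3 + (sigma (sigma (sigma p')) + sigma (sigma (sigma (sigma x))) *
        sigma (sigma (sigma (sigma (sigma x)))) - sigma (sigma x)) * b)
      (-(sigma (sigma (sigma (sigma x))) * b ^ 2)) (sigma (sigma (sigma x)) * b ^ 3)) 0
    rw [T]
    refine (congrArg _ this).trans ?_
    change r 0 ᵥ* b ᵥ* b + r 0 = _
    rw [vecMul_add, vecMul_one, pow_two, ← vecMul_vecMul]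
  have hzero : (b ^ 2 + 1) * (y * sigma y * b - y * sigma y * b ^ 3) = 0 := by
    have hc : b ^ 2 * (y * sigma y) = y * sigma y * b ^ 2 := by rw [b_sq_mul, hn, hn]
    rw [← mul_sub, ← mul_assoc, add_mul, hc, one_mul]
    have : (b ^ 2 + 1) * (b - b ^ 3) = 0 := by decide +kernel
    rw [show y * sigma y * b ^ 2 + y * sigma y = y * sigma y * (b ^ 2 + 1) by
      rw [mul_add, mul_one], mul_assoc, this, mul_zero]
  rw [hprod, blockMat_T_cube, hy, h0, vecMul_vecMul, hzero, vecMul_zero, Units.val_one,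
    ← blockMat_zero_one]
  refine blockMat_inj.2 ⟨?_, rfl⟩
  ext1 j
  fin_cases j <;> rfl

theorem mul_pow_six {q f : GL Idx (ZMod 3)} (hq : q ∈ blockGroup) {m : ℕ}
    (h : f * uA ^ m = uA ^ m * uB ^ 2) : (q * f) ^ 6 = 1 := by
  have hq' : (uA ^ m)⁻¹ * q * uA ^ m ∈ blockGroup :=
    (Subgroup.mem_normalizer_iff''.1 (pow_mem uA_mem_normalizer m) q).1 hq
  have e : q * f = uA ^ m * ((uA ^ m)⁻¹ * q * uA ^ m * uB ^ 2) * (uA ^ m)⁻¹ := by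
    rw [eq_mul_inv_iff_mul_eq, mul_assoc, h]
    group
  rw [e, conj_pow, mul_uB_sq_pow_six hq', mul_one, mul_inv_cancel]

theorem mul_pow_twelve {q : GL Idx (ZMod 3)} (hq : q ∈ blockGroup) {i j : ℕ} (hi : i < 5)
    (hj : j < 4) (h0 : j ≠ 0) : (q * (uA ^ i * uB ^ j)) ^ 12 = 1 := by
  -- Elements of a Frobenius group outside the kernel are conjugate into the complement: the first
  -- alternative is the case of an involution (j = 2), the second that of an element of order 4.
  have key : ∀ i < 5, ∀ j < 4, j ≠ 0 → ∃ m < 5, a ^ i * b ^ j * a ^ m = a ^ m * b ^ 2 ∨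
      (a ^ i * b ^ j) ^ 2 * a ^ m = a ^ m * b ^ 2 := by decide +kernel
  obtain ⟨m, -, h | h⟩ := key i hi j hj h0
  · rw [show 12 = 6 * 2 by rfl, pow_mul, mul_pow_six hq (m := m), one_pow]
    apply Units.ext
    have := congrArg blockDiag h
    simpa only [map_mul, map_pow, Units.val_mul, Units.val_pow_eq_pow_val, uA_val, uB_val]
      using this
  · set f := uA ^ i * uB ^ j with hf
    have hfN : f ∈ Subgroup.normalizer (blockGroup : Set (GL Idx (ZMod 3))) :=
      mul_mem (pow_mem uA_mem_normalizer i) (pow_mem uB_mem_normalizer j)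
    have hq' := blockGroup.mul_mem hq ((Subgroup.mem_normalizer_iff.1 hfN q).1 hq)
    have e : (q * f) ^ 2 = q * (f * q * f⁻¹) * f ^ 2 := by
      rw [pow_two, pow_two]; group
    rw [show 12 = 2 * 6 by rfl, pow_mul, e, mul_pow_six hq' (m := m)]
    apply Units.ext
    have := congrArg blockDiag h
    simpa only [map_mul, map_pow, Units.val_mul, Units.val_pow_eq_pow_val, uA_val, uB_val, hf]
      using this

/-! ### The subgroup `F` -/

theorem orderOf_uA : orderOf uA = 5 := by
  have : Fact (Nat.Prime 5) := ⟨by norm_num⟩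
  refine orderOf_eq_prime uA_pow_five fun h => ?_
  have h1 : blockDiag a = blockDiag 1 := by rw [← uA_val, h, map_one, Units.val_one]
  exact absurd (blockDiag_injective h1) (by decide +kernel)

theorem orderOf_uB : orderOf uB = 4 := by
  refine orderOf_eq_prime_pow (p := 2) (n := 1) (fun h => ?_) uB_pow_four
  have h1 : blockDiag (b ^ 2) = blockDiag 1 := by
    rw [map_pow, ← uB_val, ← Units.val_pow_eq_pow_val, map_one]
    exact congrArg Units.val h
  exact absurd (blockDiag_injective h1) (by decide +kernel)

theorem orderOf_fA : orderOf fA = 5 := by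
  rw [← Subgroup.orderOf_coe, ← Subgroup.orderOf_coe]
  exact orderOf_uA

theorem orderOf_fB : orderOf fB = 4 := by
  rw [← Subgroup.orderOf_coe, ← Subgroup.orderOf_coe]
  exact orderOf_uB

theorem card_zpowers_fA : Nat.card (Subgroup.zpowers fA) = 5 := by
  rw [Nat.card_zpowers, orderOf_fA]

theorem card_zpowers_fB : Nat.card (Subgroup.zpowers fB) = 4 := by
  rw [Nat.card_zpowers, orderOf_fB]

/-- The elements of `F` as matrices. -/
def FtoMatrix : F →* Matrix Idx Idx (ZMod 3) :=
  (Units.coeHom _).comp (G.subtype.comp F.subtype)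

theorem FtoMatrix_injective : Function.Injective FtoMatrix := fun _ _ h =>
  Subtype.ext (Subtype.ext (Units.ext h))

theorem FtoMatrix_fA : FtoMatrix fA = blockDiag a := rfl

theorem FtoMatrix_fB : FtoMatrix fB = blockDiag b := rfl

theorem closure_fA_fB : Subgroup.closure {fA, fB} = (⊤ : Subgroup F) := by
  refine (congrArg Subgroup.closure ?_).trans
    (Subgroup.closure_closure_coe_preimage (k := {gA, gB}))
  ext f
  change _ ↔ (f : G) ∈ ({gA, gB} : Set G)
  simp only [Set.mem_insert_iff, Set.mem_singleton_iff, Subtype.ext_iff]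
  rfl

theorem fB_mul_fA : fB * fA = fA ^ 3 * fB := by
  apply FtoMatrix_injective
  rw [map_mul, map_mul, map_pow, FtoMatrix_fA, FtoMatrix_fB, ← map_mul, ← map_pow, ← map_mul,
    b_mul_a]

instance zpowers_fA_normal : (Subgroup.zpowers fA).Normal := by
  rw [← Subgroup.normalizer_eq_top_iff, eq_top_iff, ← closure_fA_fB, Subgroup.closure_le]
  rintro f (rfl | rfl)
  · exact Subgroup.le_normalizer (Subgroup.mem_zpowers fA)
  · refine Subgroup.mem_normalizer_fintype ?_
    rintro _ ⟨k, rfl⟩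
    change fB * fA ^ k * fB⁻¹ ∈ Subgroup.zpowers fA
    rw [← conj_zpow, fB_mul_fA, mul_inv_cancel_right]
    exact zpow_mem (pow_mem (Subgroup.mem_zpowers fA) 3) k

theorem isComplement'_zpowers :
    Subgroup.IsComplement' (Subgroup.zpowers fA) (Subgroup.zpowers fB) := by
  refine Subgroup.isComplement'_of_disjoint_and_mul_eq_univ
    (Subgroup.disjoint_of_coprime_natCard ?_) ?_
  · rw [card_zpowers_fA, card_zpowers_fB]; decide
  · rw [← Subgroup.normal_mul, Set.eq_univ_iff_forall]
    intro f
    have : (⊤ : Subgroup F) ≤ Subgroup.zpowers fA ⊔ Subgroup.zpowers fB := by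
      rw [← closure_fA_fB, Subgroup.closure_le]
      rintro f (rfl | rfl)
      · exact Subgroup.mem_sup_left (Subgroup.mem_zpowers fA)
      · exact Subgroup.mem_sup_right (Subgroup.mem_zpowers fB)
    exact this trivial

theorem card_F : Nat.card F = 20 := by
  rw [← isComplement'_zpowers.card_mul_card, card_zpowers_fA, card_zpowers_fB]

theorem exists_pow_of_mem_zpowers {Γ : Type*} [Group Γ] {x y : Γ} {n : ℕ} (hn : 0 < n)
    (hx : orderOf x = n) (hy : y ∈ Subgroup.zpowers x) : ∃ i < n, x ^ i = y := by
  classical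
  have hx' : IsOfFinOrder x := orderOf_pos_iff.1 (hx ▸ hn)
  have h := hx'.mem_powers_iff_mem_range_orderOf.1 (hx'.mem_powers_iff_mem_zpowers.2 hy)
  simpa [hx] using h

theorem F_exists_pow (f : F) : ∃ i < 5, ∃ j < 4, f = fA ^ i * fB ^ j := by
  obtain ⟨⟨⟨x, hx⟩, ⟨y, hy⟩⟩, h⟩ := isComplement'_zpowers.2 f
  obtain ⟨i, hi, rfl⟩ := exists_pow_of_mem_zpowers (by norm_num) orderOf_fA hx
  obtain ⟨j, hj, rfl⟩ := exists_pow_of_mem_zpowers (by norm_num) orderOf_fB hy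
  exact ⟨i, hi, j, hj, h.symm⟩

theorem F_isFrobenius : IsFrobenius (Subgroup.zpowers fA) (Subgroup.zpowers fB) where
  normal := zpowers_fA_normal
  isComplement := isComplement'_zpowers
  kernel_ne_bot h := by
    have := card_zpowers_fA
    rw [h, Subgroup.card_bot] at this
    omega
  complement_ne_bot h := by
    have := card_zpowers_fB
    rw [h, Subgroup.card_bot] at this
    omega
  fixedPointFree h hh h1 k hk hc := by
    obtain ⟨i, hi, rfl⟩ := exists_pow_of_mem_zpowers (by norm_num) orderOf_fA hk
    obtain ⟨j, hj, rfl⟩ := exists_pow_of_mem_zpowers (by norm_num) orderOf_fB hh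
    have key : ∀ i < 5, ∀ j < 4, b ^ j * a ^ i = a ^ i * b ^ j → j = 0 ∨ i = 0 := by
      decide +kernel
    have e := congrArg FtoMatrix hc
    simp only [map_mul, map_pow, FtoMatrix_fA, FtoMatrix_fB] at e
    simp only [← map_mul, ← map_pow] at e
    rcases key i hi j hj (blockDiag_injective e) with rfl | rfl
    · exact absurd (pow_zero fB) h1
    · exact pow_zero fA

/-! ### The subgroup `P` -/

theorem G_le_normalizer : G ≤ Subgroup.normalizer (blockGroup : Set (GL Idx (ZMod 3))) := by
  rw [G, Subgroup.closure_le]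
  rintro g (rfl | rfl | rfl | rfl)
  · exact uA_mem_normalizer
  · exact uB_mem_normalizer
  · exact Subgroup.le_normalizer uC_mem_blockGroup
  · exact Subgroup.le_normalizer uD_mem_blockGroup

/-- `blockGroup` is normalized by `G` and contains `C` and `D`; conversely `P`, being normal,
satisfies the hypotheses of `blockGroup_le`. -/
theorem P_map : P.map G.subtype = blockGroup := by
  apply le_antisymm
  · rw [Subgroup.map_le_iff_le_comap]
    have : (blockGroup.subgroupOf G).Normal :=
      Subgroup.normal_subgroupOf_of_le_normalizer G_le_normalizer
    refine Subgroup.normalClosure_le_normal (N := blockGroup.subgroupOf G) ?_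
    rintro g (rfl | rfl)
    · exact uC_mem_blockGroup
    · exact uD_mem_blockGroup
  · refine blockGroup_le ⟨gC, Subgroup.subset_normalClosure (by simp), rfl⟩
      ⟨gD, Subgroup.subset_normalClosure (by simp), rfl⟩ ?_
    rintro _ ⟨k, hk, rfl⟩
    refine ⟨gA⁻¹ * k * gA, ?_, rfl⟩
    have := Subgroup.normalClosure_normal.conj_mem k hk gA⁻¹
    rwa [inv_inv] at this

theorem mem_P {g : G} : g ∈ P ↔ (g : GL Idx (ZMod 3)) ∈ blockGroup := by
  rw [← P_map]
  exact (Subgroup.mem_map_iff_mem G.subtype_injective).symm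

instance P_normal : P.Normal := Subgroup.normalClosure_normal

theorem card_P : Nat.card P = 3 ^ 24 := by
  rw [← card_blockGroup, ← P_map, Subgroup.card_map_of_injective G.subtype_injective]

theorem P_isPGroup : IsPGroup 3 P := IsPGroup.of_card card_P

theorem P_isComplement' : Subgroup.IsComplement' P F := by
  refine Subgroup.isComplement'_of_disjoint_and_mul_eq_univ
    (Subgroup.disjoint_of_coprime_natCard ?_) ?_
  · rw [card_P, card_F]; norm_num
  · rw [← Subgroup.normal_mul, Set.eq_univ_iff_forall]
    intro g
    have htop : Subgroup.closure {gA, gB, gC, gD} = (⊤ : Subgroup G) := by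
      refine (congrArg Subgroup.closure ?_).trans
        (Subgroup.closure_closure_coe_preimage (k := {uA, uB, uC, uD}))
      ext f
      change _ ↔ (f : GL Idx (ZMod 3)) ∈ ({uA, uB, uC, uD} : Set (GL Idx (ZMod 3)))
      simp only [Set.mem_insert_iff, Set.mem_singleton_iff, Subtype.ext_iff]
      rfl
    have : (⊤ : Subgroup G) ≤ P ⊔ F := by
      rw [← htop, Subgroup.closure_le]
      rintro f (rfl | rfl | rfl | rfl)
      · exact Subgroup.mem_sup_right (Subgroup.subset_closure (by simp))
      · exact Subgroup.mem_sup_right (Subgroup.subset_closure (by simp))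
      · exact Subgroup.mem_sup_left (Subgroup.subset_normalClosure (by simp))
      · exact Subgroup.mem_sup_left (Subgroup.subset_normalClosure (by simp))
    exact this trivial

theorem card_G : Nat.card G = 2 ^ 2 * 3 ^ 24 * 5 := by
  rw [← P_isComplement'.card_mul_card, card_P, card_F]
  norm_num

theorem card_quotient_P : Nat.card (G ⧸ P) = 20 := by
  rw [Nat.card_congr P_isComplement'.symm.QuotientMulEquiv.toEquiv, card_F]

/-- The image of a 3-element in the quotient by `P`, of order 20, is trivial. -/
theorem le_P_of_isPGroup (N : Subgroup G) (hN : IsPGroup 3 N) : N ≤ P := by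
  intro n hn
  obtain ⟨k, hk⟩ := hN ⟨n, hn⟩
  have hk : n ^ 3 ^ k = 1 := congrArg Subtype.val hk
  rw [← QuotientGroup.eq_one_iff, ← orderOf_eq_one_iff]
  refine Nat.eq_one_of_dvd_coprimes (a := 3 ^ k) (b := 20) (Nat.Coprime.pow_left k (by decide)) ?_ ?_
  · rw [orderOf_dvd_iff_pow_eq_one, ← QuotientGroup.mk_pow, hk, QuotientGroup.mk_one]
  · rw [← card_quotient_P]; exact orderOf_dvd_natCard _

theorem F_isSolvable : Group.IsSolvable F := by
  rw [Group.isSolvable_iff_subgroup_quotient (Subgroup.zpowers fA)]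
  have e := isComplement'_zpowers.symm.QuotientMulEquiv
  exact ⟨inferInstance, Group.isSolvable_of_surjective (f := e.symm.toMonoidHom) e.symm.surjective⟩

theorem G_isSolvable : Group.IsSolvable G := by
  rw [Group.isSolvable_iff_subgroup_quotient P]
  have : Fact (Nat.Prime 3) := ⟨Nat.prime_three⟩
  have : Group.IsNilpotent P := P_isPGroup.isNilpotent
  have := F_isSolvable
  have e := P_isComplement'.symm.QuotientMulEquiv
  exact ⟨inferInstance, Group.isSolvable_of_surjective (f := e.symm.toMonoidHom) e.symm.surjective⟩

/-! ### Element orders -/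

theorem P_pow_nine {g : G} (hg : g ∈ P) : g ^ 9 = 1 :=
  Subtype.ext (blockGroup_pow_nine (mem_P.1 hg))

theorem exists_mem_P_orderOf_eq_nine : ∃ g ∈ P, orderOf g = 9 := by
  -- For x = 1 the cube has last row block `r 0 (b - b^3)`. The vector `d` would not do, being fixed
  -- by `b`.
  have hne : (![0, 1, 0, 0] : Fin 4 → ZMod 3) ᵥ* (b - b ^ 3) ≠ 0 := by decide +kernel
  have : Fact (Nat.Prime 3) := ⟨Nat.prime_three⟩
  have h1 : Units.ofPowEqOne (blockMat ![![0, 1, 0, 0], 0, 0, 0] (T 1 0)) 9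
      (blockMat_T_pow_nine _ _ _) (by norm_num) ∈ blockGroup :=
    ⟨_, 1, L.one_mem, 0, L.zero_mem, rfl⟩
  obtain ⟨g, hg, h⟩ := P_map.symm ▸ h1
  refine ⟨g, hg, orderOf_eq_prime_pow (p := 3) (n := 1) (fun h3 => ?_) (P_pow_nine hg)⟩
  have h4 : blockMat ![![0, 1, 0, 0], 0, 0, 0] (T 1 0) ^ 3 = 1 := by
    have e := congrArg Units.val (congrArg Subtype.val h3)
    have e2 : (g : GL Idx (ZMod 3)).val = blockMat ![![0, 1, 0, 0], 0, 0, 0] (T 1 0) :=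
      congrArg Units.val h
    rw [← e2]
    exact e
  rw [blockMat_T_cube, ← blockMat_zero_one] at h4
  have h5 := congrFun (blockMat_inj.1 h4).1 3
  simp only [map_one, one_mul] at h5
  exact hne h5

theorem P_exponent : Monoid.exponent P = 9 := by
  apply Nat.dvd_antisymm
  · exact Monoid.exponent_dvd_of_forall_pow_eq_one fun g => Subtype.ext (P_pow_nine g.2)
  · obtain ⟨g, hg, h⟩ := exists_mem_P_orderOf_eq_nine
    rw [← h, ← Subgroup.orderOf_mk g hg]
    exact Monoid.order_dvd_exponent _

theorem G_pow_eq_one (g : G) : g ^ 5 = 1 ∨ g ^ 9 = 1 ∨ g ^ 12 = 1 := by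
  obtain ⟨⟨⟨p, hp⟩, f⟩, rfl⟩ := P_isComplement'.2 g
  obtain ⟨i, hi, j, hj, rfl⟩ := F_exists_pow f
  have hq := mem_P.1 hp
  change (p * (gA ^ i * gB ^ j)) ^ 5 = 1 ∨ (p * (gA ^ i * gB ^ j)) ^ 9 = 1 ∨
    (p * (gA ^ i * gB ^ j)) ^ 12 = 1
  obtain rfl | hj0 := eq_or_ne j 0
  · obtain rfl | hi0 := eq_or_ne i 0
    · rw [pow_zero, pow_zero, mul_one, mul_one]
      exact .inr (.inl (P_pow_nine hp))
    · rw [pow_zero, mul_one]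
      exact .inl (Subtype.ext (mul_uA_pow_pow_five hq hi hi0))
  · exact .inr (.inr (Subtype.ext (mul_pow_twelve hq hi hj hj0)))

/-! ### Order 12 in G from the commuting elements C and B -/

theorem matC_cube : matC ^ 3 = 1 := by
  rw [matC_eq, blockMat_T_cube, ← blockMat_zero_one, blockMat_inj, Pi.zero_apply, zero_vecMul]
  refine ⟨?_, rfl⟩
  ext1 j
  fin_cases j <;> rfl

theorem matC_ne_one : matC ≠ 1 := fun h => by
  rw [matC_eq, ← blockMat_zero_one, ← T_zero] at h
  exact one_ne_zero (T_injOn L.zero_mem L.zero_mem (blockMat_inj.1 h).2).1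

/-- `C` has row 0 and parameters 1 and 0, all fixed under conjugation by `B`. -/
theorem matC_mul_matB : matC * matB = matB * matC := by
  rw [matC_eq, blockMat_T_mul_matB, map_one, map_one, map_one, map_zero, map_zero, map_zero]
  simp only [Pi.zero_apply, zero_vecMul]
  rfl

theorem orderOf_uC : orderOf uC = 3 := by
  have : Fact (Nat.Prime 3) := ⟨Nat.prime_three⟩
  refine orderOf_eq_prime (Units.ext ?_) fun h => matC_ne_one (congrArg Units.val h)
  rw [Units.val_pow_eq_pow_val]
  exact matC_cube

theorem uC_mul_uB : uC * uB = uB * uC := by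
  refine Units.ext ?_
  rw [Units.val_mul, Units.val_mul, show (uC : Matrix Idx Idx (ZMod 3)) = matC from rfl, uB_val,
    ← matB_eq, matC_mul_matB]

theorem orderOf_mul_of_commute {Γ : Type*} [Group Γ] {x y : Γ} {m n : ℕ} (h : x * y = y * x)
    (hx : orderOf x = m) (hy : orderOf y = n) (hmn : m.Coprime n) : orderOf (x * y) = m * n := by
  subst hx hy
  exact (show Commute x y from h).orderOf_mul_eq_mul_orderOf_of_coprime hmn

theorem G_exists_orderOf_eq_twelve : ∃ g : G, orderOf g = 12 := by
  have h := orderOf_mul_of_commute (x := uC) (y := uB) (m := 3) (n := 4) uC_mul_uB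
    orderOf_uC orderOf_uB (by norm_num)
  rw [show 3 * 4 = 12 by norm_num] at h
  exact ⟨⟨_, G.mul_mem gC.2 gB.2⟩, (Subgroup.orderOf_mk _ _).trans h⟩

theorem elementOrders_G : elementOrders G = {n | n ∣ 5 ∨ n ∣ 9 ∨ n ∣ 12} := by
  obtain ⟨g, -, hg⟩ := exists_mem_P_orderOf_eq_nine
  refine elementOrders_of_dvd G_pow_eq_one ⟨gA, ?_⟩ ⟨g, hg⟩ G_exists_orderOf_eq_twelve
  rw [← Subgroup.orderOf_coe]
  exact orderOf_uA

end SolvIso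

theorem proposition3p1 :
    -- `G` is solvable, of the stated order, and isospectral to `S₄(3)`
    Group.IsSolvable SolvIso.G ∧
    Nat.card SolvIso.G = 2 ^ 2 * 3 ^ 24 * 5 ∧
    SolvIso.Isospectral SolvIso.G SolvIso.S43 ∧
    SolvIso.maxElementOrders SolvIso.S43 = {5, 9, 12} ∧
    -- `G` is the semidirect product of its normal subgroup `P` by `F`
    SolvIso.P.Normal ∧
    Subgroup.IsComplement' SolvIso.P SolvIso.F ∧
    -- `P` is the largest normal `3`-subgroup, of exponent `9` and order `3 ^ 24`
    IsPGroup 3 SolvIso.P ∧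
    (∀ N : Subgroup SolvIso.G, N.Normal → IsPGroup 3 N → N ≤ SolvIso.P) ∧
    Monoid.exponent SolvIso.P = 9 ∧
    Nat.card SolvIso.P = 3 ^ 24 ∧
    -- `F` is a Frobenius group with cyclic kernel of order `5` and cyclic complement of order `4`
    SolvIso.IsFrobenius (Subgroup.zpowers SolvIso.fA) (Subgroup.zpowers SolvIso.fB) ∧
    Nat.card (Subgroup.zpowers SolvIso.fA) = 5 ∧
    Nat.card (Subgroup.zpowers SolvIso.fB) = 4 := by
  exact ⟨SolvIso.G_isSolvable, SolvIso.card_G,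
    SolvIso.elementOrders_G.trans SolvIso.elementOrders_S43.symm,
    SolvIso.maxElementOrders_of_elementOrders SolvIso.elementOrders_S43, SolvIso.P_normal,
    SolvIso.P_isComplement', SolvIso.P_isPGroup, fun N _ hN => SolvIso.le_P_of_isPGroup N hN,
    SolvIso.P_exponent, SolvIso.card_P, SolvIso.F_isFrobenius, SolvIso.card_zpowers_fA,
    SolvIso.card_zpowers_fB⟩
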